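/- Let $n\ge 1$ and let $\mathcal B=(a_1,b_1)\times\dots\times(a_n,b_n)\subset\mathbb R^n$ with $a_i<b_i$ be a rectangular box. For $\alpha\in\mathbb R$ and $k\geq 1$ let $\lambda_k(\mathcal B;\alpha)$ be the $k$-th eigenvalue, counted with multiplicity, of the Robin Laplacian ($-\Delta u=\lambda u$ in $\mathcal B$, $\partial u/\partial\nu+\alpha u=0$ on $\partial\mathcal B$), that is, $$\lambda_k(\mathcal B;\alpha)=\min_{U_k}\max_{u\in U_k\setminus 0}\frac{\int_{\mathcal B}|\nabla u|^2\,dx+\alpha\int_{\partial\mathcal B}u^2\,dS}{\int_{\mathcal B}u^2\,dx},$$ where $U_k$ ranges over the $k$-dimensional subspaces of $H^1(\mathcal B)$, and let $\delta_k(\mathcal B)$ be the $k$-th eigenvalue of the Dirichlet Laplacian on $\mathcal B$, given by the minimax of $\int_{\mathcal B}|\nabla u|^2\,dx\,/\int_{\mathcal B}u^2\,dx$ over the $k$-dimensional subspaces of $H^1_0(\mathcal B)$. Then the function $\alpha\mapsto(\lambda_2-\lambda_1)(\mathcal B;\alpha)$ is strictly increasing on $\mathbb R$, and $$\lim_{\alpha\to-\infty}(\lambda_2-\lambda_1)(\mathcal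 B;\alpha)=0,\qquad \lim_{\alpha\to\infty}(\lambda_2-\lambda_1)(\mathcal B;\alpha)=\delta_2(\mathcal B)-\delta_1(\mathcal B).$$ -/

import Mathlib

open MeasureTheory Filter Topology
open scoped ContDiff

namespace RobinBox

/-- The open rectangular box `(a 0, b 0) × ⋯ × (a (n-1), b (n-1))` in `ℝⁿ`. -/
def box {n : ℕ} (a b : Fin n → ℝ) : Set (Fin n → ℝ) :=
  Set.univ.pi fun i => Set.Ioo (a i) (b i)

/-- Lebesgue measure on the box. -/
noncomputable def boxMeasure {n : ℕ} (a b : Fin n → ℝ) : Measure (Fin n → ℝ) :=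
  (volume : Measure (Fin n → ℝ)).restrict (box a b)

/-- Surface measure on the face of the box where the `j`-th coordinate equals `c`:
a unit mass at `c` in the `j`-th coordinate, and Lebesgue measure on `(a i, b i)` in every
other coordinate `i`. -/
noncomputable def faceMeasure {n : ℕ} (a b : Fin n → ℝ) (j : Fin n) (c : ℝ) :
    Measure (Fin n → ℝ) :=
  Measure.pi fun i =>
    if i = j then Measure.dirac c else (volume : Measure ℝ).restrict (Set.Ioo (a i) (b i))

/-- Surface measure `dS` on the boundary of the box: the sum over the `2n` faces (edges and
corners are null sets; for `n = 1` it is the counting measure on the two endpoints). -/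
noncomputable def boundaryMeasure {n : ℕ} (a b : Fin n → ℝ) : Measure (Fin n → ℝ) :=
  ∑ j : Fin n, (faceMeasure a b j (a j) + faceMeasure a b j (b j))

/-- The real Hilbert space `L²` of the box. -/
abbrev L2Box {n : ℕ} (a b : Fin n → ℝ) : Type := Lp ℝ 2 (boxMeasure a b)

/-- The real Hilbert space `L²` of the boundary of the box. -/
abbrev L2Boundary {n : ℕ} (a b : Fin n → ℝ) : Type := Lp ℝ 2 (boundaryMeasure a b)

/-- The classical partial derivative `∂φ/∂x_j`. -/
noncomputable def partialDeriv {n : ℕ} (j : Fin n) (φ : (Fin n → ℝ) → ℝ) (x : Fin n → ℝ) : ℝ :=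
  fderiv ℝ φ x (Pi.single j 1)

/-- `φ` is a test function on the box: smooth, with compact support inside the open box. -/
def IsTestFunction {n : ℕ} (a b : Fin n → ℝ) (φ : (Fin n → ℝ) → ℝ) : Prop :=
  ContDiff ℝ ∞ φ ∧ HasCompactSupport φ ∧ tsupport φ ⊆ box a b

/-- `G = (G 0, …, G (n-1))`, with components in `L²`, is the weak gradient of `u` on the box. -/
def HasWeakGradient {n : ℕ} (a b : Fin n → ℝ) (u : L2Box a b) (G : Fin n → L2Box a b) : Prop :=
  ∀ j : Fin n, ∀ φ : (Fin n → ℝ) → ℝ, IsTestFunction a b φ →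
    ∫ x, u x * partialDeriv j φ x ∂(boxMeasure a b) = - ∫ x, G j x * φ x ∂(boxMeasure a b)

/-- `u` belongs to the Sobolev space `H¹` of the box. -/
def MemH1 {n : ℕ} (a b : Fin n → ℝ) (u : L2Box a b) : Prop :=
  ∃ G : Fin n → L2Box a b, HasWeakGradient a b u G

/-- The sequence of smooth functions `φ m` converges in the `H¹` norm of the box to `u`. -/
def TendstoH1 {n : ℕ} (a b : Fin n → ℝ) (φ : ℕ → (Fin n → ℝ) → ℝ) (u : L2Box a b) : Prop :=
  ∃ G : Fin n → L2Box a b, HasWeakGradient a b u G ∧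
    Tendsto (fun m => eLpNorm (fun x => φ m x - u x) 2 (boxMeasure a b)) atTop (𝓝 0) ∧
    ∀ j : Fin n, Tendsto
      (fun m => eLpNorm (fun x => partialDeriv j (φ m) x - G j x) 2 (boxMeasure a b))
      atTop (𝓝 0)

/-- `g` is the trace on the boundary of the `H¹` function `u`: the limit in `L²` of the boundary of
the boundary values of smooth functions that converge to `u` in `H¹`. (The trace operator is the
continuous extension of restriction to the boundary; every `H¹` function on a box has exactly one
trace.) -/
def HasTrace {n : ℕ} (a b : Fin n → ℝ) (u : L2Box a b) (g : L2Boundary a b) : Prop :=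
  ∃ φ : ℕ → (Fin n → ℝ) → ℝ, (∀ m, ContDiff ℝ ∞ (φ m)) ∧ TendstoH1 a b φ u ∧
    Tendsto (fun m => eLpNorm (fun x => φ m x - g x) 2 (boundaryMeasure a b)) atTop (𝓝 0)

/-- `u` belongs to `H¹₀` of the box: the closure of the test functions in `H¹`. -/
def MemH10 {n : ℕ} (a b : Fin n → ℝ) (u : L2Box a b) : Prop :=
  ∃ φ : ℕ → (Fin n → ℝ) → ℝ, (∀ m, IsTestFunction a b (φ m)) ∧ TendstoH1 a b φ u

/-- `r` is the Robin Rayleigh quotient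
`(∫ |∇u|² dx + α ∫_∂ u² dS) / ∫ u² dx` of the function `u`, with the weak gradient and the trace
of `u` (both of which exist and are unique for `u` in `H¹`). -/
def IsRobinQuotient {n : ℕ} (a b : Fin n → ℝ) (α : ℝ) (u : L2Box a b) (r : ℝ) : Prop :=
  ∃ (G : Fin n → L2Box a b) (g : L2Boundary a b), HasWeakGradient a b u G ∧ HasTrace a b u g ∧
    r = ((∑ j, ‖G j‖ ^ 2) + α * ‖g‖ ^ 2) / ‖u‖ ^ 2

/-- `r` is the Dirichlet Rayleigh quotient `∫ |∇u|² dx / ∫ u² dx` of the function `u`. -/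
def IsDirichletQuotient {n : ℕ} (a b : Fin n → ℝ) (u : L2Box a b) (r : ℝ) : Prop :=
  ∃ G : Fin n → L2Box a b, HasWeakGradient a b u G ∧ r = (∑ j, ‖G j‖ ^ 2) / ‖u‖ ^ 2

/-- The `k`-th eigenvalue `λ_k` (`k = 1, 2, …`, with multiplicity) of the Robin Laplacian
`-Δu = λu` in the box, `∂u/∂ν + αu = 0` on the boundary, by the minimax principle: the infimum,
over the `k`-dimensional subspaces `U` of `H¹`, of the maximum of the Rayleigh quotient over
`U \ {0}`; that is, the infimum of the numbers `c` that bound the quotient on some such `U`. -/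
noncomputable def robinEigenvalue {n : ℕ} (a b : Fin n → ℝ) (α : ℝ) (k : ℕ) : ℝ :=
  sInf {c : ℝ | ∃ U : Submodule ℝ (L2Box a b), Module.finrank ℝ U = k ∧
    (∀ u ∈ U, MemH1 a b u) ∧
    ∀ u ∈ U, u ≠ 0 → ∃ r, IsRobinQuotient a b α u r ∧ r ≤ c}

/-- The `k`-th Dirichlet eigenvalue `δ_k` (`k = 1, 2, …`, with multiplicity) of the Laplacian on
the box, by the minimax principle over the `k`-dimensional subspaces of `H¹₀`. -/
noncomputable def dirichletEigenvalue {n : ℕ} (a b : Fin n → ℝ) (k : ℕ) : ℝ :=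
  sInf {c : ℝ | ∃ U : Submodule ℝ (L2Box a b), Module.finrank ℝ U = k ∧
    (∀ u ∈ U, MemH10 a b u) ∧
    ∀ u ∈ U, u ≠ 0 → ∃ r, IsDirichletQuotient a b u r ∧ r ≤ c}

/-- The spectral gap `λ₂ - λ₁` of the Robin Laplacian on the box. -/
noncomputable def robinGap {n : ℕ} (a b : Fin n → ℝ) (α : ℝ) : ℝ :=
  robinEigenvalue a b α 2 - robinEigenvalue a b α 1

/-- The spectral gap `δ₂ - δ₁` of the Dirichlet Laplacian on the box. -/
noncomputable def dirichletGap {n : ℕ} (a b : Fin n → ℝ) : ℝ :=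
  dirichletEigenvalue a b 2 - dirichletEigenvalue a b 1

end RobinBox

namespace RobinBox

/-! ### The Robin problem on a half interval `[0, ℓ]` -/

/-! The argument is separation of variables, carried out directly on the minimax formulas, without
spectral theory. Move the midpoint of each side to `0` and write `ℓ` for its half length. An even
positive solution (`IsEvenState`) and an odd solution positive on `(0, ℓ]` (`IsOddState`) give the
first two Robin eigenvalues `lam < mu` of the side. For the box, `λ₁ = ∑ lam i` and `λ₂ = λ₁ + min
(mu i - lam i)`, so its gap is the smallest of the side gaps (`robinGap_eq`). The assertions then
reduce to one interval, since a minimum of finitely many numbers is continuous and strictly monotone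
under strict increase of all entries.

Monotonicity on an interval (`gap_lt_gap`): for `α < β`, with primes denoting the states at `β`, the
Wronskian identity expresses the increments as `(β - α) φ(ℓ)φ'(ℓ) / ∫ φφ'` for the even states and
`(β - α) ψ(ℓ)ψ'(ℓ) / ∫ ψψ'` for the odd ones. The ratio of odd to even state increases strictly on
`[0, ℓ]` at each parameter, so `ψψ'`, scaled to be `1` at `ℓ`, lies below `φφ'` scaled likewise. Its
integral is smaller, and the odd eigenvalue grows more. The limits come from the explicit states:
`cos`, `1`, `cosh` in the even case and `sin`, `x`, `sinh` in the odd case.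

Lower bounds on the box: on an interval the energy dominates `lam ‖f‖² + g (‖f‖² - ⟨f, χ⟩²)` with
`χ` the normalized even state (`IsEvenState.isGroundState`, from Jacobi's inequality on each half).
This form of inequality passes to products with the same `g` by tensorization of the variance
(`le_boxEnergy`), and then to `H¹` by approximation (`le_robinForm`). A line then has quotient at
least `∑ lam i`, while a plane contains a vector orthogonal to the product ground state. Upper
bounds use products of the one-dimensional states, where a plane is obtained by varying one factor.

For the Dirichlet eigenvalues, `H¹₀` functions have trace zero, so every Dirichlet bound is a Robin
bound for every `α`. Letting `α → ∞` in the Robin lower bounds gives the Dirichlet ones, and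
products of sines and cosines attain them (`dirichletGap_eq`). -/

lemma smooth_hasDerivAt {f : ℝ → ℝ} (hf : ContDiff ℝ ∞ f) (x : ℝ) :
    HasDerivAt f (deriv f x) x :=
  (hf.differentiable (by simp)).differentiableAt.hasDerivAt

lemma smooth_deriv {f : ℝ → ℝ} (hf : ContDiff ℝ ∞ f) : ContDiff ℝ ∞ (deriv f) :=
  (contDiff_infty_iff_deriv.1 hf).2

/-- `φ` is a smooth solution of `-φ'' = lam φ`. -/
structure IsSolution (lam : ℝ) (φ : ℝ → ℝ) : Prop where
  smooth : ContDiff ℝ ∞ φ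
  ode : ∀ x, deriv (deriv φ) x = -lam * φ x

/-- `φ` is an even eigenfunction of the Robin problem on `(-ℓ, ℓ)`, without zeros. -/
structure IsEvenState (ℓ α lam : ℝ) (φ : ℝ → ℝ) : Prop extends IsSolution lam φ where
  even : ∀ x, φ (-x) = φ x
  deriv_zero : deriv φ 0 = 0
  pos : ∀ x ∈ Set.Icc 0 ℓ, 0 < φ x
  bc : deriv φ ℓ = -α * φ ℓ

/-- `ψ` is an odd eigenfunction of the Robin problem on `(-ℓ, ℓ)`, positive on `(0, ℓ]`. -/
structure IsOddState (ℓ α mu : ℝ) (ψ : ℝ → ℝ) : Prop extends IsSolution mu ψ where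
  odd : ∀ x, ψ (-x) = -ψ x
  deriv_zero : 0 < deriv ψ 0
  pos : ∀ x ∈ Set.Ioc 0 ℓ, 0 < ψ x
  bc : deriv ψ ℓ = -α * ψ ℓ

lemma IsOddState.zero {ℓ α mu : ℝ} {ψ : ℝ → ℝ} (h : IsOddState ℓ α mu ψ) : ψ 0 = 0 := by
  have := h.odd 0
  simp only [neg_zero] at this
  linarith

/-- The Wronskian identity. -/
lemma wronskian_integral {lam nu : ℝ} {u v : ℝ → ℝ} (hu : IsSolution lam u)
    (hv : IsSolution nu v) (x y : ℝ) :
    (lam - nu) * ∫ t in x..y, u t * v t =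
      (u y * deriv v y - deriv u y * v y) - (u x * deriv v x - deriv u x * v x) := by
  rw [← intervalIntegral.integral_const_mul]
  refine intervalIntegral.integral_eq_sub_of_hasDerivAt
    (f := fun t => u t * deriv v t - deriv u t * v t) (fun t _ => ?_) ?_
  · have h1 := smooth_hasDerivAt hu.smooth t
    have h2 := smooth_hasDerivAt hv.smooth t
    have h3 := smooth_hasDerivAt (smooth_deriv hu.smooth) t
    have h4 := smooth_hasDerivAt (smooth_deriv hv.smooth) t
    rw [hu.ode] at h3
    rw [hv.ode] at h4
    refine ((h1.mul h4).sub (h3.mul h2)).congr_deriv ?_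
    ring
  · have := hu.smooth.continuous
    have := hv.smooth.continuous
    exact Continuous.intervalIntegrable (by fun_prop) _ _

lemma integral_deriv_mul_solution {lam : ℝ} {φ f : ℝ → ℝ} (hφ : IsSolution lam φ)
    (hf : ContDiff ℝ ∞ f) (x y : ℝ) :
    ∫ t in x..y, deriv f t * deriv φ t =
      f y * deriv φ y - f x * deriv φ x + lam * ∫ t in x..y, f t * φ t := by
  have hc1 := hf.continuous
  have hc2 := (smooth_deriv hf).continuous
  have hc3 := hφ.smooth.continuous
  have hc4 := (smooth_deriv hφ.smooth).continuous
  have key := intervalIntegral.integral_eq_sub_of_hasDerivAt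
    (f := fun t => f t * deriv φ t) (f' := fun t => deriv f t * deriv φ t - lam * (f t * φ t))
    (a := x) (b := y) (fun t _ => ?_) (Continuous.intervalIntegrable (by fun_prop) _ _)
  · rw [intervalIntegral.integral_sub (Continuous.intervalIntegrable (by fun_prop) _ _)
      (Continuous.intervalIntegrable (by fun_prop) _ _),
      intervalIntegral.integral_const_mul] at key
    linarith
  · have h1 := smooth_hasDerivAt hf t
    have h4 := smooth_hasDerivAt (smooth_deriv hφ.smooth) t
    rw [hφ.ode] at h4
    refine (h1.mul h4).congr_deriv ?_
    ring

/-- The Wronskian vanishes at `0` because both derivatives do, and at `ℓ` only the difference of the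
Robin parameters survives. This replaces the derivative of the eigenvalue in `α` by an exact
difference quotient, so no differentiability in `α` is needed. -/
lemma IsEvenState.secant {ℓ α β lam nu : ℝ} {φ χ : ℝ → ℝ} (h : IsEvenState ℓ α lam φ)
    (k : IsEvenState ℓ β nu χ) :
    (nu - lam) * ∫ t in (0 : ℝ)..ℓ, φ t * χ t = (β - α) * (φ ℓ * χ ℓ) := by
  have := wronskian_integral h.toIsSolution k.toIsSolution 0 ℓ
  rw [h.bc, k.bc, h.deriv_zero, k.deriv_zero] at this
  linarith

lemma IsOddState.secant {ℓ α β lam nu : ℝ} {φ χ : ℝ → ℝ} (h : IsOddState ℓ α lam φ)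
    (k : IsOddState ℓ β nu χ) :
    (nu - lam) * ∫ t in (0 : ℝ)..ℓ, φ t * χ t = (β - α) * (φ ℓ * χ ℓ) := by
  have := wronskian_integral h.toIsSolution k.toIsSolution 0 ℓ
  rw [h.bc, k.bc, h.zero, k.zero] at this
  linarith

lemma integral_mul_pos {ℓ : ℝ} (hℓ : 0 < ℓ) {f g : ℝ → ℝ} (hf : Continuous f)
    (hg : Continuous g) (hf0 : ∀ x ∈ Set.Ioc 0 ℓ, 0 < f x) (hg0 : ∀ x ∈ Set.Ioc 0 ℓ, 0 < g x) :
    0 < ∫ t in (0 : ℝ)..ℓ, f t * g t :=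
  intervalIntegral.intervalIntegral_pos_of_pos_on
    (Continuous.intervalIntegrable (by fun_prop) _ _)
    (fun x hx => mul_pos (hf0 x ⟨hx.1, hx.2.le⟩) (hg0 x ⟨hx.1, hx.2.le⟩)) hℓ

lemma IsEvenState.pos' {ℓ α lam : ℝ} {φ : ℝ → ℝ} (h : IsEvenState ℓ α lam φ) :
    ∀ x ∈ Set.Ioc 0 ℓ, 0 < φ x := fun x hx => h.pos x ⟨hx.1.le, hx.2⟩

/-- The secant identity at equal parameters, with positive integrand. Eigenvalues can therefore be
computed from any convenient state. -/
lemma IsEvenState.unique {ℓ α lam nu : ℝ} {φ χ : ℝ → ℝ} (hℓ : 0 < ℓ)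
    (h : IsEvenState ℓ α lam φ) (k : IsEvenState ℓ α nu χ) : lam = nu := by
  have h1 := h.secant k
  have h2 := integral_mul_pos hℓ h.smooth.continuous k.smooth.continuous h.pos' k.pos'
  rw [sub_self, zero_mul, mul_eq_zero] at h1
  rcases h1 with h1 | h1 <;> linarith

lemma IsOddState.unique {ℓ α lam nu : ℝ} {φ χ : ℝ → ℝ} (hℓ : 0 < ℓ)
    (h : IsOddState ℓ α lam φ) (k : IsOddState ℓ α nu χ) : lam = nu := by
  have h1 := h.secant k
  have h2 := integral_mul_pos hℓ h.smooth.continuous k.smooth.continuous h.pos k.pos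
  rw [sub_self, zero_mul, mul_eq_zero] at h1
  rcases h1 with h1 | h1 <;> linarith

/-! ### Comparison of the even and the odd state at one parameter. -/

section Pair

variable {ℓ α lam mu : ℝ} {φ ψ : ℝ → ℝ}

/-- The common Robin condition kills the Wronskian at `ℓ`, while at `0` it equals `φ 0 * deriv ψ 0 >
0`. -/
lemma IsEvenState.lt_of_isOddState (hℓ : 0 < ℓ) (h : IsEvenState ℓ α lam φ)
    (k : IsOddState ℓ α mu ψ) : lam < mu := by
  have h1 := wronskian_integral h.toIsSolution k.toIsSolution 0 ℓ
  rw [h.bc, k.bc, h.deriv_zero, k.zero] at h1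
  have h2 := integral_mul_pos hℓ h.smooth.continuous k.smooth.continuous h.pos' k.pos
  have h3 := mul_pos (h.pos 0 ⟨le_rfl, hℓ.le⟩) k.deriv_zero
  by_contra hcon
  have := mul_nonneg (sub_nonneg.2 (not_lt.1 hcon)) h2.le
  linarith

lemma IsEvenState.wronskian_pos (hℓ : 0 < ℓ) (h : IsEvenState ℓ α lam φ)
    (k : IsOddState ℓ α mu ψ) {x : ℝ} (hx : x ∈ Set.Ico 0 ℓ) :
    0 < φ x * deriv ψ x - deriv φ x * ψ x := by
  have h1 := wronskian_integral h.toIsSolution k.toIsSolution x ℓ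
  rw [h.bc, k.bc] at h1
  have hc1 := h.smooth.continuous
  have hc2 := k.smooth.continuous
  have h2 : 0 < ∫ t in x..ℓ, φ t * ψ t :=
    intervalIntegral.intervalIntegral_pos_of_pos_on
      (Continuous.intervalIntegrable (by fun_prop) _ _)
      (fun y hy => mul_pos (h.pos y ⟨hx.1.trans hy.1.le, hy.2.le⟩)
        (k.pos y ⟨hx.1.trans_lt hy.1, hy.2.le⟩)) hx.2
  have := mul_pos (sub_pos.2 (h.lt_of_isOddState hℓ k)) h2
  linarith

/-- The numerator of the derivative of `ψ / φ` is the Wronskian, positive on `[0, ℓ)`. The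
inequality is cross-multiplied so that two parameters can be multiplied together. -/
lemma IsEvenState.ratio_lt (hℓ : 0 < ℓ) (h : IsEvenState ℓ α lam φ)
    (k : IsOddState ℓ α mu ψ) {x : ℝ} (hx : x ∈ Set.Ico 0 ℓ) :
    ψ x * φ ℓ < φ x * ψ ℓ := by
  have hmono : StrictMonoOn (fun t => ψ t / φ t) (Set.Icc 0 ℓ) := by
    have hd : ∀ t ∈ Set.Icc 0 ℓ, HasDerivAt (fun t => ψ t / φ t)
        ((deriv ψ t * φ t - ψ t * deriv φ t) / φ t ^ 2) t := fun t ht =>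
      (smooth_hasDerivAt k.smooth t).div (smooth_hasDerivAt h.smooth t) (h.pos t ht).ne'
    refine strictMonoOn_of_deriv_pos (convex_Icc _ _)
      (fun t ht => (hd t ht).continuousAt.continuousWithinAt) (fun t ht => ?_)
    rw [interior_Icc] at ht
    rw [(hd t ⟨ht.1.le, ht.2.le⟩).deriv]
    have := h.wronskian_pos hℓ k ⟨ht.1.le, ht.2⟩
    have h3 := h.pos t ⟨ht.1.le, ht.2.le⟩
    apply div_pos _ (by positivity)
    linarith
  have := hmono ⟨hx.1, hx.2.le⟩ ⟨hℓ.le, le_rfl⟩ hx.2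
  rw [div_lt_div_iff₀ (h.pos x ⟨hx.1, hx.2.le⟩) (h.pos ℓ ⟨hℓ.le, le_rfl⟩)] at this
  linarith

end Pair

/-- The gap between the first odd and the first even eigenvalue is strictly increasing. -/
lemma gap_lt_gap {ℓ α β lam mu lam' mu' : ℝ} {φ ψ φ' ψ' : ℝ → ℝ} (hℓ : 0 < ℓ) (hαβ : α < β)
    (h : IsEvenState ℓ α lam φ) (k : IsOddState ℓ α mu ψ)
    (h' : IsEvenState ℓ β lam' φ') (k' : IsOddState ℓ β mu' ψ') :
    mu - lam < mu' - lam' := by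
  have s1 := h.secant h'
  have s2 := k.secant k'
  have hX := integral_mul_pos hℓ h.smooth.continuous h'.smooth.continuous h.pos' h'.pos'
  have hY := integral_mul_pos hℓ k.smooth.continuous k'.smooth.continuous k.pos k'.pos
  have hp := mul_pos (h.pos ℓ ⟨hℓ.le, le_rfl⟩) (h'.pos ℓ ⟨hℓ.le, le_rfl⟩)
  have hq := mul_pos (k.pos ℓ ⟨hℓ, le_rfl⟩) (k'.pos ℓ ⟨hℓ, le_rfl⟩)
  have hc1 := h.smooth.continuous
  have hc2 := k.smooth.continuous
  have hc3 := h'.smooth.continuous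
  have hc4 := k'.smooth.continuous
  -- Multiply the ratio inequalities of the two parameters. Equality holds at `ℓ`; strictness at the
  -- single point `0` suffices by continuity.
  have hlt : (∫ t in (0 : ℝ)..ℓ, (φ ℓ * φ' ℓ) * (ψ t * ψ' t)) <
      ∫ t in (0 : ℝ)..ℓ, (ψ ℓ * ψ' ℓ) * (φ t * φ' t) := by
    have hpt : ∀ x ∈ Set.Ico 0 ℓ, (φ ℓ * φ' ℓ) * (ψ x * ψ' x) < (ψ ℓ * ψ' ℓ) * (φ x * φ' x) := by
      intro x hx
      have e1 := h.ratio_lt hℓ k hx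
      have e2 := h'.ratio_lt hℓ k' hx
      have hnn : 0 ≤ ψ' x * φ' ℓ := by
        rcases hx.1.eq_or_lt with h0 | h0
        · rw [← h0, k'.zero, zero_mul]
        · exact (mul_pos (k'.pos x ⟨h0, hx.2.le⟩) (h'.pos ℓ ⟨hℓ.le, le_rfl⟩)).le
      have := mul_lt_mul'' e1 e2 ?_ hnn
      · calc _ = ψ x * φ ℓ * (ψ' x * φ' ℓ) := by ring
          _ < _ := this
          _ = _ := by ring
      · rcases hx.1.eq_or_lt with h0 | h0
        · rw [← h0, k.zero, zero_mul]
        · exact (mul_pos (k.pos x ⟨h0, hx.2.le⟩) (h.pos ℓ ⟨hℓ.le, le_rfl⟩)).le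
    refine intervalIntegral.integral_lt_integral_of_continuousOn_of_le_of_exists_lt hℓ
      (Continuous.continuousOn (by fun_prop)) (Continuous.continuousOn (by fun_prop))
      (fun x hx => ?_) ⟨0, ⟨le_rfl, hℓ.le⟩, hpt 0 ⟨le_rfl, hℓ⟩⟩
    rcases hx.2.eq_or_lt with h0 | h0
    · rw [h0]
      exact le_of_eq (by ring)
    · exact (hpt x ⟨hx.1.le, h0⟩).le
  rw [intervalIntegral.integral_const_mul, intervalIntegral.integral_const_mul] at hlt
  set X := ∫ t in (0 : ℝ)..ℓ, φ t * φ' t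
  set Y := ∫ t in (0 : ℝ)..ℓ, ψ t * ψ' t
  have e1 : lam' - lam = (β - α) * (φ ℓ * φ' ℓ) / X := by rw [← s1]; field_simp
  have e2 : mu' - mu = (β - α) * (ψ ℓ * ψ' ℓ) / Y := by rw [← s2]; field_simp
  have : lam' - lam < mu' - mu := by
    rw [e1, e2, div_lt_div_iff₀ hX hY, mul_assoc, mul_assoc (β - α)]
    exact mul_lt_mul_of_pos_left hlt (sub_pos.2 hαβ)
  linarith

/-- The Robin energy on the half interval. -/
noncomputable def halfEnergy (ℓ α : ℝ) (f : ℝ → ℝ) : ℝ :=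
  (∫ t in (0 : ℝ)..ℓ, deriv f t ^ 2) + α * f ℓ ^ 2

/-- Jacobi's inequality: the odd state gives the best constant under a Dirichlet condition
at `0`. -/
lemma IsOddState.le_halfEnergy {ℓ α mu : ℝ} {ψ f : ℝ → ℝ} (hℓ : 0 < ℓ)
    (k : IsOddState ℓ α mu ψ) (hf : ContDiff ℝ ∞ f) (hf0 : f 0 = 0) :
    mu * ∫ t in (0 : ℝ)..ℓ, f t ^ 2 ≤ halfEnergy ℓ α f := by
  have hcf := hf.continuous
  have hcf' := (smooth_deriv hf).continuous
  have hψℓ := k.pos ℓ ⟨hℓ, le_rfl⟩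
  have hint : ∀ x y : ℝ, IntervalIntegrable (fun t => deriv f t ^ 2 - mu * f t ^ 2) volume x y :=
    fun x y => Continuous.intervalIntegrable (by fun_prop) _ _
  -- Completing the square: `f'² - mu f² = (f' - (ψ'/ψ) f)² + ((ψ'/ψ) f²)'`, integrated from `x > 0`
  -- because `ψ` vanishes at `0`.
  have step : ∀ x ∈ Set.Ioo 0 ℓ, -(deriv ψ x / ψ x * f x ^ 2) ≤
      (∫ t in x..ℓ, (deriv f t ^ 2 - mu * f t ^ 2)) + α * f ℓ ^ 2 := by
    intro x hx
    have hpos : ∀ t ∈ Set.uIcc x ℓ, 0 < ψ t := fun t ht => by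
      rw [Set.uIcc_of_le hx.2.le] at ht
      exact k.pos t ⟨hx.1.trans_le ht.1, ht.2⟩
    have hd : ∀ t ∈ Set.uIcc x ℓ, HasDerivAt (fun t => -(deriv ψ t / ψ t * f t ^ 2))
        ((deriv f t - deriv ψ t / ψ t * f t) ^ 2 - (deriv f t ^ 2 - mu * f t ^ 2)) t := by
      intro t ht
      have h1 := smooth_hasDerivAt hf t
      have h2 := smooth_hasDerivAt k.smooth t
      have h4 := smooth_hasDerivAt (smooth_deriv k.smooth) t
      rw [k.ode] at h4
      have h0 := (hpos t ht).ne'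
      refine ((h4.div h2 h0).mul (h1.pow 2)).neg.congr_deriv ?_
      simp only [Pi.div_apply, Pi.pow_apply]
      field_simp
      push_cast
      ring
    have hcψ := k.smooth.continuous
    have hcψ' := (smooth_deriv k.smooth).continuous
    have hcont : ContinuousOn (fun t => (deriv f t - deriv ψ t / ψ t * f t) ^ 2)
        (Set.uIcc x ℓ) := by
      refine ((hcf'.continuousOn).sub ((hcψ'.continuousOn.div hcψ.continuousOn
        fun t ht => (hpos t ht).ne').mul hcf.continuousOn)).pow 2
    have key := intervalIntegral.integral_eq_sub_of_hasDerivAt hd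
      (hcont.intervalIntegrable.sub (hint x ℓ))
    rw [intervalIntegral.integral_sub hcont.intervalIntegrable (hint x ℓ), k.bc] at key
    have hnn : 0 ≤ ∫ t in x..ℓ, (deriv f t - deriv ψ t / ψ t * f t) ^ 2 :=
      intervalIntegral.integral_nonneg hx.2.le fun t _ => sq_nonneg _
    have : -α * ψ ℓ / ψ ℓ = -α := by field_simp
    rw [this] at key
    linarith
  have lim1 : Tendsto (fun x => (∫ t in x..ℓ, (deriv f t ^ 2 - mu * f t ^ 2)) + α * f ℓ ^ 2)
      (𝓝[>] 0) (𝓝 ((∫ t in (0 : ℝ)..ℓ, (deriv f t ^ 2 - mu * f t ^ 2)) + α * f ℓ ^ 2)) := by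
    have hcont : Continuous fun x => ∫ t in x..ℓ, (deriv f t ^ 2 - mu * f t ^ 2) := by
      simp_rw [intervalIntegral.integral_symm ℓ]
      exact (intervalIntegral.continuous_primitive hint ℓ).neg
    exact ((hcont.tendsto 0).add_const _).mono_left nhdsWithin_le_nhds
  -- `ψ'/ψ` blows up only like `1/x`, while `f²` is of order `x²` because `f 0 = 0`.
  have lim2 : Tendsto (fun x => -(deriv ψ x / ψ x * f x ^ 2)) (𝓝[>] 0) (𝓝 0) := by
    have s1 : Tendsto (fun x => x⁻¹ * f x) (𝓝[>] 0) (𝓝 (deriv f 0)) := by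
      have := (smooth_hasDerivAt hf 0).tendsto_slope_zero_right
      simpa [hf0] using this
    have s2 : Tendsto (fun x => x⁻¹ * ψ x) (𝓝[>] 0) (𝓝 (deriv ψ 0)) := by
      have := (smooth_hasDerivAt k.smooth 0).tendsto_slope_zero_right
      simpa [k.zero] using this
    have s3 : Tendsto (deriv ψ) (𝓝[>] 0) (𝓝 (deriv ψ 0)) :=
      ((smooth_deriv k.smooth).continuous.tendsto 0).mono_left nhdsWithin_le_nhds
    have s4 : Tendsto f (𝓝[>] 0) (𝓝 0) := by
      have := (hcf.tendsto 0).mono_left (nhdsWithin_le_nhds (s := Set.Ioi 0))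
      rwa [hf0] at this
    have := (((s3.div s2 k.deriv_zero.ne').mul s1).mul s4).neg
    rw [mul_zero, neg_zero] at this
    refine this.congr' ?_
    filter_upwards [self_mem_nhdsWithin] with x hx
    have hx' : x ≠ 0 := (Set.mem_Ioi.1 hx).ne'
    simp only [Pi.div_apply]
    field_simp
  have fin := le_of_tendsto_of_tendsto lim2 lim1
    (by filter_upwards [Ioo_mem_nhdsGT hℓ] with x hx using step x hx)
  rw [intervalIntegral.integral_sub (Continuous.intervalIntegrable (by fun_prop) _ _)
    (Continuous.intervalIntegrable (by fun_prop) _ _), intervalIntegral.integral_const_mul] at fin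
  unfold halfEnergy
  linarith

/-- The lower bound for the energy on the half interval, after subtracting the multiple of the
even state which agrees with `f` at `0`. -/
lemma le_halfEnergy_of_states {ℓ α lam mu k : ℝ} {φ ψ f : ℝ → ℝ} (hℓ : 0 < ℓ)
    (h : IsEvenState ℓ α lam φ) (h' : IsOddState ℓ α mu ψ) (hf : ContDiff ℝ ∞ f)
    (hk : f 0 = k * φ 0) :
    (mu * ∫ t in (0 : ℝ)..ℓ, f t ^ 2) - (mu - lam) *
      (2 * k * (∫ t in (0 : ℝ)..ℓ, f t * φ t) - k ^ 2 * ∫ t in (0 : ℝ)..ℓ, φ t ^ 2) ≤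
        halfEnergy ℓ α f := by
  have hcf := hf.continuous
  have hcf' := (smooth_deriv hf).continuous
  have hcφ := h.smooth.continuous
  have hcφ' := (smooth_deriv h.smooth).continuous
  have hi : ∀ {g : ℝ → ℝ}, Continuous g → IntervalIntegrable g volume 0 ℓ :=
    fun hg => hg.intervalIntegrable _ _
  have hw : ContDiff ℝ ∞ (fun t => f t - k * φ t) := hf.sub (contDiff_const.mul h.smooth)
  have key := h'.le_halfEnergy hℓ hw (by rw [hk, sub_self])
  have hdw : deriv (fun t => f t - k * φ t) = fun t => deriv f t - k * deriv φ t := by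
    ext t
    exact ((smooth_hasDerivAt hf t).sub ((smooth_hasDerivAt h.smooth t).const_mul k)).deriv
  have e1 : ∫ t in (0 : ℝ)..ℓ, (f t - k * φ t) ^ 2 = (∫ t in (0 : ℝ)..ℓ, f t ^ 2) -
      2 * k * (∫ t in (0 : ℝ)..ℓ, f t * φ t) + k ^ 2 * ∫ t in (0 : ℝ)..ℓ, φ t ^ 2 := by
    rw [← intervalIntegral.integral_const_mul, ← intervalIntegral.integral_const_mul,
      ← intervalIntegral.integral_sub (hi (by fun_prop)) (hi (by fun_prop)),
      ← intervalIntegral.integral_add (hi (by fun_prop)) (hi (by fun_prop))]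
    congr 1; ext t; ring
  have e2 : ∫ t in (0 : ℝ)..ℓ, (deriv f t - k * deriv φ t) ^ 2 =
      (∫ t in (0 : ℝ)..ℓ, deriv f t ^ 2) - 2 * k * (∫ t in (0 : ℝ)..ℓ, deriv f t * deriv φ t) +
        k ^ 2 * ∫ t in (0 : ℝ)..ℓ, deriv φ t * deriv φ t := by
    rw [← intervalIntegral.integral_const_mul, ← intervalIntegral.integral_const_mul,
      ← intervalIntegral.integral_sub (hi (by fun_prop)) (hi (by fun_prop)),
      ← intervalIntegral.integral_add (hi (by fun_prop)) (hi (by fun_prop))]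
    congr 1; ext t; ring
  -- The mixed energy of `f` and `φ` is `lam ∫ f φ`: there is no boundary term at `0`, and the one
  -- at `ℓ` cancels against the Robin term.
  have e3 := integral_deriv_mul_solution h.toIsSolution hf 0 ℓ
  have e4 := integral_deriv_mul_solution h.toIsSolution h.smooth 0 ℓ
  have e5 : ∫ t in (0 : ℝ)..ℓ, φ t * φ t = ∫ t in (0 : ℝ)..ℓ, φ t ^ 2 := by simp_rw [sq]
  rw [h.deriv_zero, h.bc] at e3 e4
  unfold halfEnergy at key ⊢
  rw [hdw, e1, e2, e3, e4, e5] at key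
  nlinarith [key]

/-- The two terms are the halves of `s φ + t ψ` on the symmetric interval; even-odd cross terms
cancel in the sum. The boundary conditions are multiplied by the value at `ℓ` so that they also hold
for functions vanishing there, which covers the Dirichlet case. -/
lemma halfEnergy_add_halfEnergy {ℓ α lam mu : ℝ} {φ ψ : ℝ → ℝ}
    (h : IsSolution lam φ) (h0 : deriv φ 0 = 0) (hb : φ ℓ * deriv φ ℓ = -α * φ ℓ ^ 2)
    (h' : IsSolution mu ψ) (h0' : ψ 0 = 0) (hb' : ψ ℓ * deriv ψ ℓ = -α * ψ ℓ ^ 2) (s t : ℝ) :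
    halfEnergy ℓ α (fun x => s * φ x + t * ψ x) + halfEnergy ℓ α (fun x => s * φ x - t * ψ x) =
      2 * (s ^ 2 * (lam * ∫ x in (0 : ℝ)..ℓ, φ x ^ 2) +
        t ^ 2 * (mu * ∫ x in (0 : ℝ)..ℓ, ψ x ^ 2)) := by
  have hcφ := h.smooth.continuous
  have hcφ' := (smooth_deriv h.smooth).continuous
  have hcψ := h'.smooth.continuous
  have hcψ' := (smooth_deriv h'.smooth).continuous
  have hi : ∀ {g : ℝ → ℝ}, Continuous g → IntervalIntegrable g volume 0 ℓ :=
    fun hg => hg.intervalIntegrable _ _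
  have hd1 : deriv (fun x => s * φ x + t * ψ x) = fun x => s * deriv φ x + t * deriv ψ x := by
    ext x
    exact (((smooth_hasDerivAt h.smooth x).const_mul s).add
      ((smooth_hasDerivAt h'.smooth x).const_mul t)).deriv
  have hd2 : deriv (fun x => s * φ x - t * ψ x) = fun x => s * deriv φ x - t * deriv ψ x := by
    ext x
    exact (((smooth_hasDerivAt h.smooth x).const_mul s).sub
      ((smooth_hasDerivAt h'.smooth x).const_mul t)).deriv
  have e : (∫ x in (0 : ℝ)..ℓ, (s * deriv φ x + t * deriv ψ x) ^ 2) +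
      (∫ x in (0 : ℝ)..ℓ, (s * deriv φ x - t * deriv ψ x) ^ 2) =
      2 * s ^ 2 * (∫ x in (0 : ℝ)..ℓ, deriv φ x * deriv φ x) +
        2 * t ^ 2 * (∫ x in (0 : ℝ)..ℓ, deriv ψ x * deriv ψ x) := by
    rw [← intervalIntegral.integral_add (hi (by fun_prop)) (hi (by fun_prop)),
      ← intervalIntegral.integral_const_mul, ← intervalIntegral.integral_const_mul,
      ← intervalIntegral.integral_add (hi (by fun_prop)) (hi (by fun_prop))]
    congr 1; ext x; ring
  have e3 := integral_deriv_mul_solution h h.smooth 0 ℓ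
  have e4 := integral_deriv_mul_solution h' h'.smooth 0 ℓ
  have e5 : ∫ t in (0 : ℝ)..ℓ, φ t * φ t = ∫ t in (0 : ℝ)..ℓ, φ t ^ 2 := by simp_rw [sq]
  have e6 : ∫ t in (0 : ℝ)..ℓ, ψ t * ψ t = ∫ t in (0 : ℝ)..ℓ, ψ t ^ 2 := by simp_rw [sq]
  rw [h0, hb, e5] at e3
  rw [h0', hb', e6] at e4
  unfold halfEnergy
  rw [hd1, hd2]
  rw [e3, e4] at e
  linear_combination e

/-! ### Existence of the states and their asymptotics -/

lemma deriv_cos_mul (θ : ℝ) : deriv (fun x => Real.cos (θ * x)) = fun x => -θ * Real.sin (θ * x) := by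
  ext x
  exact ((((hasDerivAt_id x).const_mul θ).cos).congr_deriv (by simp; ring)).deriv

lemma deriv_sin_mul (θ : ℝ) : deriv (fun x => Real.sin (θ * x)) = fun x => θ * Real.cos (θ * x) := by
  ext x
  exact ((((hasDerivAt_id x).const_mul θ).sin).congr_deriv (by simp; ring)).deriv

lemma deriv_cosh_mul (θ : ℝ) : deriv (fun x => Real.cosh (θ * x)) = fun x => θ * Real.sinh (θ * x) := by
  ext x
  exact ((((hasDerivAt_id x).const_mul θ).cosh).congr_deriv (by simp; ring)).deriv

lemma deriv_sinh_mul (θ : ℝ) : deriv (fun x => Real.sinh (θ * x)) = fun x => θ * Real.cosh (θ * x) := by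
  ext x
  exact ((((hasDerivAt_id x).const_mul θ).sinh).congr_deriv (by simp; ring)).deriv

lemma isSolution_cos (θ : ℝ) : IsSolution (θ ^ 2) (fun x => Real.cos (θ * x)) where
  smooth := by fun_prop
  ode x := by
    rw [deriv_cos_mul, deriv_const_mul_field, deriv_sin_mul]; ring

lemma isSolution_sin (θ : ℝ) : IsSolution (θ ^ 2) (fun x => Real.sin (θ * x)) where
  smooth := by fun_prop
  ode x := by
    rw [deriv_sin_mul, deriv_const_mul_field, deriv_cos_mul]; ring

lemma isEvenState_cos {ℓ α θ : ℝ} (hθ : 0 < θ) (hθℓ : θ * ℓ < Real.pi / 2)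
    (h : θ * Real.sin (θ * ℓ) = α * Real.cos (θ * ℓ)) :
    IsEvenState ℓ α (θ ^ 2) (fun x => Real.cos (θ * x)) where
  toIsSolution := isSolution_cos θ
  even x := by simp
  deriv_zero := by simp [deriv_cos_mul]
  pos x hx := by
    apply Real.cos_pos_of_mem_Ioo
    have h1 := mul_nonneg hθ.le hx.1
    have h2 := mul_le_mul_of_nonneg_left hx.2 hθ.le
    constructor <;> linarith [Real.pi_pos]
  bc := by rw [deriv_cos_mul]; linarith

lemma isEvenState_const (ℓ : ℝ) : IsEvenState ℓ 0 0 (fun _ => 1) where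
  smooth := contDiff_const
  ode x := by simp
  even x := rfl
  deriv_zero := by simp
  pos x _ := one_pos
  bc := by simp

lemma isEvenState_cosh {ℓ α θ : ℝ} (h : θ * Real.sinh (θ * ℓ) = -α * Real.cosh (θ * ℓ)) :
    IsEvenState ℓ α (-θ ^ 2) (fun x => Real.cosh (θ * x)) where
  smooth := by
    have := Real.contDiff_cosh (n := ∞)
    fun_prop
  ode x := by
    rw [deriv_cosh_mul, deriv_const_mul_field, deriv_sinh_mul]; ring
  even x := by simp
  deriv_zero := by simp [deriv_cosh_mul]
  pos x hx := Real.cosh_pos _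
  bc := by rw [deriv_cosh_mul]; exact h

lemma isOddState_sin {ℓ α κ : ℝ} (hκ : 0 < κ) (hκℓ : κ * ℓ < Real.pi)
    (h : κ * Real.cos (κ * ℓ) = -α * Real.sin (κ * ℓ)) :
    IsOddState ℓ α (κ ^ 2) (fun x => Real.sin (κ * x)) where
  toIsSolution := isSolution_sin κ
  odd x := by simp
  deriv_zero := by simpa [deriv_sin_mul] using hκ
  pos x hx := by
    have h2 := mul_le_mul_of_nonneg_left hx.2 hκ.le
    exact Real.sin_pos_of_pos_of_lt_pi (mul_pos hκ hx.1) (by linarith)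
  bc := by rw [deriv_sin_mul]; exact h

lemma isOddState_id {ℓ : ℝ} (hℓ : 0 < ℓ) : IsOddState ℓ (-1 / ℓ) 0 (fun x => x) where
  smooth := contDiff_id
  ode x := by simp
  odd x := rfl
  deriv_zero := by simp
  pos x hx := hx.1
  bc := by
    rw [deriv_id'']
    field_simp

lemma isOddState_sinh {ℓ α κ : ℝ} (hκ : 0 < κ)
    (h : κ * Real.cosh (κ * ℓ) = -α * Real.sinh (κ * ℓ)) :
    IsOddState ℓ α (-κ ^ 2) (fun x => Real.sinh (κ * x)) where
  smooth := by
    have := Real.contDiff_sinh (n := ∞)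
    fun_prop
  ode x := by
    rw [deriv_sinh_mul, deriv_const_mul_field, deriv_cosh_mul]; ring
  odd x := by simp
  deriv_zero := by simpa [deriv_sinh_mul] using hκ
  pos x hx := Real.sinh_pos_iff.2 (mul_pos hκ hx.1)
  bc := by rw [deriv_sinh_mul]; exact h

lemma exists_cos_state {ℓ α : ℝ} (hℓ : 0 < ℓ) (hα : 0 < α) :
    ∃ θ, 0 < θ ∧ θ * ℓ < Real.pi / 2 ∧ θ * Real.sin (θ * ℓ) = α * Real.cos (θ * ℓ) := by
  have hpi := Real.pi_pos
  have h0 : 0 < Real.pi / (2 * ℓ) := by positivity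
  have h1 : Real.pi / (2 * ℓ) * ℓ = Real.pi / 2 := by field_simp
  have hc : ContinuousOn (fun θ => θ * Real.sin (θ * ℓ) - α * Real.cos (θ * ℓ))
      (Set.Icc 0 (Real.pi / (2 * ℓ))) := by fun_prop
  obtain ⟨θ, hθ, h⟩ := intermediate_value_Ioo h0.le hc (show (0 : ℝ) ∈ _ from by
    simp only [h1]
    constructor
    · simpa using hα
    · simpa using h0)
  refine ⟨θ, hθ.1, ?_, by simp only at h; linarith⟩
  rw [← h1]
  exact mul_lt_mul_of_pos_right hθ.2 hℓ

lemma exists_cosh_state {ℓ A : ℝ} (hℓ : 0 < ℓ) (hA : 0 < A) :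
    ∃ θ, 0 < θ ∧ θ * Real.sinh (θ * ℓ) = A * Real.cosh (θ * ℓ) := by
  -- At this right endpoint the summand `1 / ℓ` makes `θ ℓ ≥ 1`, hence `cosh ≤ 2 sinh`, and the
  -- summand `2 A` then makes `θ sinh` at least `A cosh`.
  have h0 : 0 < 2 * A + 1 / ℓ := by positivity
  have hc : ContinuousOn (fun θ => θ * Real.sinh (θ * ℓ) - A * Real.cosh (θ * ℓ))
      (Set.Icc 0 (2 * A + 1 / ℓ)) :=
    Continuous.continuousOn ((continuous_id.mul (Real.continuous_sinh.comp (by fun_prop))).sub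
      (continuous_const.mul (Real.continuous_cosh.comp (by fun_prop))))
  obtain ⟨θ, hθ, h⟩ := intermediate_value_Ioc h0.le hc (show (0 : ℝ) ∈ _ from by
    constructor
    · simpa using hA
    · have hx : 1 ≤ (2 * A + 1 / ℓ) * ℓ := by
        have : (2 * A + 1 / ℓ) * ℓ = 2 * A * ℓ + 1 := by field_simp
        rw [this]
        have : 0 < 2 * A * ℓ := by positivity
        linarith
      set x := (2 * A + 1 / ℓ) * ℓ
      have hs : 1 ≤ Real.sinh x := hx.trans (Real.self_le_sinh_iff.2 (by linarith))
      have hcs := Real.cosh_sq x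
      have hcosh : Real.cosh x ≤ 2 * Real.sinh x :=
        abs_le_of_sq_le_sq' (by nlinarith) (by linarith) |>.2
      have h2 : 2 * A * Real.sinh x ≤ (2 * A + 1 / ℓ) * Real.sinh x := by
        apply mul_le_mul_of_nonneg_right _ (by linarith)
        have : 0 < 1 / ℓ := by positivity
        linarith
      have := mul_le_mul_of_nonneg_left hcosh hA.le
      linarith)
  exact ⟨θ, hθ.1, by simp only at h; linarith⟩

lemma exists_sin_state {ℓ α : ℝ} (hℓ : 0 < ℓ) (hα : -1 / ℓ < α) :
    ∃ κ, 0 < κ ∧ κ * ℓ < Real.pi ∧ κ * Real.cos (κ * ℓ) = -α * Real.sin (κ * ℓ) := by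
  have hpi := Real.pi_pos
  have h0 : 0 < Real.pi / ℓ := by positivity
  have h1 : Real.pi / ℓ * ℓ = Real.pi := by field_simp
  -- Dividing by `κ` removes the trivial root `κ = 0`. The value at `0` becomes `-(1 + α ℓ)`, whose
  -- sign is exactly the hypothesis on `α`.
  have hc : ContinuousOn (fun κ => -(Real.cos (κ * ℓ) + α * ℓ * Real.sinc (κ * ℓ)))
      (Set.Icc 0 (Real.pi / ℓ)) := by
    have := Real.continuous_sinc
    exact Continuous.continuousOn (by fun_prop)
  obtain ⟨κ, hκ, h⟩ := intermediate_value_Ioo h0.le hc (show (0 : ℝ) ∈ _ from by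
    simp only [h1]
    constructor
    · have : -1 < α * ℓ := by rwa [div_lt_iff₀ hℓ] at hα
      simp only [zero_mul, Real.cos_zero, Real.sinc_zero]
      linarith
    · rw [Real.sinc_of_ne_zero hpi.ne']
      simp)
  have hκℓ : κ * ℓ ≠ 0 := (mul_pos hκ.1 hℓ).ne'
  refine ⟨κ, hκ.1, ?_, ?_⟩
  · rw [← h1]
    exact mul_lt_mul_of_pos_right hκ.2 hℓ
  · simp only [Real.sinc_of_ne_zero hκℓ] at h
    have hκ0 := hκ.1.ne'
    field_simp at h
    linarith

lemma exists_sinh_state {ℓ A : ℝ} (hℓ : 0 < ℓ) (hA : 1 / ℓ < A) :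
    ∃ κ, 0 < κ ∧ κ * Real.cosh (κ * ℓ) = A * Real.sinh (κ * ℓ) := by
  have hA0 : 0 < A := lt_trans (by positivity) hA
  -- The trivial root at `0` is avoided by starting at a small `κ₀` with `cosh (κ₀ ℓ) < A ℓ`, where
  -- `κ₀ cosh < A κ₀ ℓ ≤ A sinh`.
  have h1 : ∀ᶠ κ in 𝓝[>] (0 : ℝ), Real.cosh (κ * ℓ) < A * ℓ := by
    have hc : Continuous fun κ : ℝ => Real.cosh (κ * ℓ) :=
      Real.continuous_cosh.comp (by fun_prop)
    have := (hc.tendsto 0).mono_left (nhdsWithin_le_nhds (s := Set.Ioi 0))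
    rw [zero_mul, Real.cosh_zero] at this
    refine this.eventually (gt_mem_nhds ?_)
    rwa [div_lt_iff₀ hℓ] at hA
  obtain ⟨κ₀, h2, h3⟩ := (h1.and (Ioo_mem_nhdsGT hA0)).exists
  have hc : ContinuousOn (fun κ => κ * Real.cosh (κ * ℓ) - A * Real.sinh (κ * ℓ))
      (Set.Icc κ₀ A) :=
    Continuous.continuousOn ((continuous_id.mul (Real.continuous_cosh.comp (by fun_prop))).sub
      (continuous_const.mul (Real.continuous_sinh.comp (by fun_prop))))
  obtain ⟨κ, hκ, h⟩ := intermediate_value_Ioo h3.2.le hc (show (0 : ℝ) ∈ _ from by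
    constructor
    · have hs : κ₀ * ℓ ≤ Real.sinh (κ₀ * ℓ) :=
        Real.self_le_sinh_iff.2 (mul_pos h3.1 hℓ).le
      have e1 := mul_lt_mul_of_pos_left h2 h3.1
      have e2 := mul_le_mul_of_nonneg_left hs hA0.le
      nlinarith
    · have := mul_lt_mul_of_pos_left (Real.sinh_lt_cosh (A * ℓ)) hA0
      linarith)
  exact ⟨κ, h3.1.trans hκ.1, by simp only at h; linarith⟩

lemma exists_isEvenState {ℓ : ℝ} (hℓ : 0 < ℓ) (α : ℝ) : ∃ lam φ, IsEvenState ℓ α lam φ := by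
  rcases lt_trichotomy α 0 with h | h | h
  · obtain ⟨θ, -, h2⟩ := exists_cosh_state hℓ (neg_pos.2 h)
    exact ⟨_, _, isEvenState_cosh h2⟩
  · exact h ▸ ⟨_, _, isEvenState_const ℓ⟩
  · obtain ⟨θ, h1, h2, h3⟩ := exists_cos_state hℓ h
    exact ⟨_, _, isEvenState_cos h1 h2 h3⟩

lemma exists_isOddState {ℓ : ℝ} (hℓ : 0 < ℓ) (α : ℝ) : ∃ mu ψ, IsOddState ℓ α mu ψ := by
  rcases lt_trichotomy α (-1 / ℓ) with h | h | h
  · obtain ⟨κ, h1, h2⟩ := exists_sinh_state (A := -α) hℓ (by rw [neg_div] at h; linarith)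
    exact ⟨_, _, isOddState_sinh h1 h2⟩
  · exact h ▸ ⟨_, _, isOddState_id hℓ⟩
  · obtain ⟨κ, h1, h2, h3⟩ := exists_sin_state hℓ h
    exact ⟨_, _, isOddState_sin h1 h2 h3⟩

/-- Any choice of even eigenvalues tends to the Dirichlet eigenvalue. -/
lemma tendsto_even_atTop {ℓ : ℝ} (hℓ : 0 < ℓ) {lam : ℝ → ℝ} {φ : ℝ → ℝ → ℝ}
    (h : ∀ α, IsEvenState ℓ α (lam α) (φ α)) :
    Tendsto lam atTop (𝓝 ((Real.pi / (2 * ℓ)) ^ 2)) := by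
  have hpi := Real.pi_pos
  choose! θ h1 h2 h3 using fun α (hα : (0 : ℝ) < α) => exists_cos_state hℓ hα
  have hθ : Tendsto θ atTop (𝓝 (Real.pi / (2 * ℓ))) := by
    have hlim : Tendsto (fun α : ℝ => Real.pi / (2 * ℓ) - Real.pi ^ 2 / (4 * ℓ ^ 2) * α⁻¹) atTop
        (𝓝 (Real.pi / (2 * ℓ))) := by
      simpa using (tendsto_const_nhds (x := Real.pi / (2 * ℓ))).sub
        (tendsto_inv_atTop_zero.const_mul (Real.pi ^ 2 / (4 * ℓ ^ 2)))
    refine tendsto_of_tendsto_of_tendsto_of_le_of_le' hlim tendsto_const_nhds ?_ ?_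
    · filter_upwards [eventually_gt_atTop 0] with α hα
      -- The boundary equation makes the cosine `O(1/α)`; Jordan's inequality `2 y / π ≤ sin y` at
      -- `y = π/2 - θ ℓ` turns this into a rate for `θ`.
      have hy : Real.cos (θ α * ℓ) ≤ Real.pi / (2 * ℓ) / α := by
        rw [le_div_iff₀ hα, mul_comm, ← h3 α hα, le_div_iff₀ (by positivity)]
        have := h2 α hα
        have h4 := Real.sin_le_one (θ α * ℓ)
        have := mul_le_mul_of_nonneg_left h4 (mul_pos (h1 α hα) hℓ).le
        nlinarith
      have hsin := Real.mul_le_sin (x := Real.pi / 2 - θ α * ℓ) (by linarith [h2 α hα])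
        (by linarith [mul_pos (h1 α hα) hℓ])
      rw [Real.sin_pi_div_two_sub] at hsin
      have hs2 := hsin.trans hy
      have e : Real.pi / (2 * ℓ) - θ α ≤ Real.pi ^ 2 / (4 * ℓ ^ 2) * α⁻¹ := by
        have : Real.pi / (2 * ℓ) - θ α =
            Real.pi / (2 * ℓ) * (2 / Real.pi * (Real.pi / 2 - θ α * ℓ)) := by field_simp
        rw [this]
        refine (mul_le_mul_of_nonneg_left hs2 (by positivity)).trans (le_of_eq ?_)
        field_simp
        ring
      linarith
    · filter_upwards [eventually_gt_atTop 0] with α hα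
      rw [le_div_iff₀ (by positivity)]
      linarith [h2 α hα]
  refine (hθ.pow 2).congr' ?_
  filter_upwards [eventually_gt_atTop 0] with α hα
  exact (isEvenState_cos (h1 α hα) (h2 α hα) (h3 α hα)).unique hℓ (h α)

/-- Any choice of odd eigenvalues tends to the Dirichlet eigenvalue. -/
lemma tendsto_odd_atTop {ℓ : ℝ} (hℓ : 0 < ℓ) {mu : ℝ → ℝ} {ψ : ℝ → ℝ → ℝ}
    (h : ∀ α, IsOddState ℓ α (mu α) (ψ α)) :
    Tendsto mu atTop (𝓝 ((Real.pi / ℓ) ^ 2)) := by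
  have hpi := Real.pi_pos
  have hneg : -1 / ℓ < 0 := by rw [neg_div]; linarith [show 0 < 1 / ℓ by positivity]
  choose! κ h1 h2 h3 using fun α (hα : (0 : ℝ) < α) => exists_sin_state hℓ (hneg.trans hα)
  have hκ : Tendsto κ atTop (𝓝 (Real.pi / ℓ)) := by
    have hlim : Tendsto (fun α : ℝ => Real.pi / ℓ - Real.pi ^ 2 / (2 * ℓ ^ 2) * α⁻¹) atTop
        (𝓝 (Real.pi / ℓ)) := by
      simpa using (tendsto_const_nhds (x := Real.pi / ℓ)).sub
        (tendsto_inv_atTop_zero.const_mul (Real.pi ^ 2 / (2 * ℓ ^ 2)))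
    refine tendsto_of_tendsto_of_tendsto_of_le_of_le' hlim tendsto_const_nhds ?_ ?_
    · filter_upwards [eventually_gt_atTop 0] with α hα
      have hpos := mul_pos (h1 α hα) hℓ
      have hspos := Real.sin_pos_of_pos_of_lt_pi hpos (h2 α hα)
      -- This places `κ ℓ` beyond `π/2`, so that Jordan's inequality applies to `π - κ ℓ`.
      have hcneg : Real.cos (κ α * ℓ) < 0 := by
        by_contra hcon
        have := mul_nonneg (h1 α hα).le (not_lt.1 hcon)
        have := mul_pos hα hspos
        linarith [h3 α hα]
      have hgt : Real.pi / 2 < κ α * ℓ := by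
        by_contra hcon
        exact hcneg.not_ge (Real.cos_nonneg_of_mem_Icc ⟨by linarith, not_lt.1 hcon⟩)
      have hy : Real.sin (κ α * ℓ) ≤ Real.pi / ℓ / α := by
        rw [le_div_iff₀ hα, le_div_iff₀ hℓ]
        have h4 := Real.neg_one_le_cos (κ α * ℓ)
        have := mul_le_mul_of_nonneg_left h4 (mul_pos (h1 α hα) hℓ).le
        have h5 := h2 α hα
        have h6 := h3 α hα
        nlinarith
      have hsin := Real.mul_le_sin (x := Real.pi - κ α * ℓ) (by linarith [h2 α hα])
        (by linarith)
      rw [Real.sin_pi_sub] at hsin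
      have hs2 := hsin.trans hy
      have e : Real.pi / ℓ - κ α ≤ Real.pi ^ 2 / (2 * ℓ ^ 2) * α⁻¹ := by
        have : Real.pi / ℓ - κ α =
            Real.pi / (2 * ℓ) * (2 / Real.pi * (Real.pi - κ α * ℓ)) := by field_simp
        rw [this]
        refine (mul_le_mul_of_nonneg_left hs2 (by positivity)).trans (le_of_eq ?_)
        field_simp
      linarith
    · filter_upwards [eventually_gt_atTop 0] with α hα
      rw [le_div_iff₀ hℓ]
      exact (h2 α hα).le
  refine (hκ.pow 2).congr' ?_
  filter_upwards [eventually_gt_atTop 0] with α hα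
  exact (isOddState_sin (h1 α hα) (h2 α hα) (h3 α hα)).unique hℓ (h α)

lemma sq_half_le_sinh {x : ℝ} (hx : 0 ≤ x) : x ^ 2 / 2 ≤ Real.sinh x := by
  have h1 : x / 2 ≤ Real.sinh (x / 2) := Real.self_le_sinh_iff.2 (by linarith)
  have h2 : x / 2 ≤ Real.cosh (x / 2) := h1.trans (Real.sinh_lt_cosh _).le
  have h3 : Real.sinh x = 2 * Real.sinh (x / 2) * Real.cosh (x / 2) := by
    rw [← Real.sinh_two_mul]; congr 1; ring
  rw [h3]
  have := mul_le_mul h1 h2 (by linarith) (by linarith)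
  linarith

/-- For any choice of eigenvalues, the gap tends to zero as `α → -∞`. -/
lemma tendsto_gap_atBot {ℓ : ℝ} (hℓ : 0 < ℓ) {lam mu : ℝ → ℝ} {φ ψ : ℝ → ℝ → ℝ}
    (h : ∀ α, IsEvenState ℓ α (lam α) (φ α)) (h' : ∀ α, IsOddState ℓ α (mu α) (ψ α)) :
    Tendsto (fun α => mu α - lam α) atBot (𝓝 0) := by
  have hlim : Tendsto (fun α : ℝ => 8 / ℓ ^ 4 * ((-α - 1 / ℓ) ^ 2)⁻¹) atBot (𝓝 0) := by
    have h1 : Tendsto (fun α : ℝ => -α - 1 / ℓ) atBot atTop :=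
      tendsto_atTop_add_const_right _ _ tendsto_neg_atBot_atTop
    have h2 := ((tendsto_pow_atTop (two_ne_zero)).comp h1).inv_tendsto_atTop.const_mul (8 / ℓ ^ 4)
    simpa using h2
  refine tendsto_of_tendsto_of_tendsto_of_le_of_le' tendsto_const_nhds hlim
    (Eventually.of_forall fun α => (sub_pos.2 ((h α).lt_of_isOddState hℓ (h' α))).le) ?_
  filter_upwards [eventually_lt_atBot (-(1 / ℓ))] with α hα
  have hA : 1 / ℓ < -α := by linarith
  have hA0 : 0 < -α := lt_trans (by positivity) hA
  obtain ⟨θ, hθ, hθ'⟩ := exists_cosh_state hℓ hA0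
  obtain ⟨κ, hκ, hκ'⟩ := exists_sinh_state hℓ hA
  have e1 := (isEvenState_cosh hθ').unique hℓ (h α)
  have e2 := (isOddState_sinh hκ hκ').unique hℓ (h' α)
  set A := -α
  have hy : 0 < A - 1 / ℓ := by linarith
  have hθℓ := mul_pos hθ hℓ
  have hκℓ := mul_pos hκ hℓ
  have hs1 := Real.sinh_pos_iff.2 hθℓ
  have hs2 := Real.sinh_pos_iff.2 hκℓ
  have hc1 := Real.cosh_pos (θ * ℓ)
  have hlt1 := Real.sinh_lt_cosh (θ * ℓ)
  have hθA : A ≤ θ := by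
    by_contra hcon
    have := mul_lt_mul'' (not_le.1 hcon) hlt1 hθ.le hs1.le
    linarith
  have hκA : A - 1 / ℓ ≤ κ := by
    -- With `exp (-x) = cosh x - sinh x` this reads `x cosh x ≤ (1 + x) sinh x`; the boundary
    -- equation then gives `A ℓ ≤ 1 + κ ℓ`.
    have hx : κ * ℓ * Real.exp (-(κ * ℓ)) ≤ Real.sinh (κ * ℓ) := by
      have : Real.exp (-(κ * ℓ)) ≤ 1 := Real.exp_le_one_iff.2 (by linarith)
      have h3 := Real.self_le_sinh_iff.2 hκℓ.le
      nlinarith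
    have hexp : Real.exp (-(κ * ℓ)) = Real.cosh (κ * ℓ) - Real.sinh (κ * ℓ) := by
      rw [Real.cosh_sub_sinh]
    rw [hexp] at hx
    have : A * ℓ * Real.sinh (κ * ℓ) ≤ (1 + κ * ℓ) * Real.sinh (κ * ℓ) := by nlinarith
    have h4 := le_of_mul_le_mul_right this hs2
    have : A - 1 / ℓ = (A * ℓ - 1) / ℓ := by field_simp
    rw [this, div_le_iff₀ hℓ]
    linarith
  -- Since `A = θ tanh (θ ℓ) = κ coth (κ ℓ)`, both `θ² - A²` and `A² - κ²` have closed forms; their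
  -- sum is the gap and avoids subtracting two large numbers.
  have hgap : mu α - lam α =
      θ ^ 2 / Real.cosh (θ * ℓ) ^ 2 + κ ^ 2 / Real.sinh (κ * ℓ) ^ 2 := by
    have hA1 : A = θ * Real.sinh (θ * ℓ) / Real.cosh (θ * ℓ) := by
      rw [hθ']; field_simp
    have hA2 : A = κ * Real.cosh (κ * ℓ) / Real.sinh (κ * ℓ) := by
      rw [hκ']; field_simp
    have f1 : θ ^ 2 / Real.cosh (θ * ℓ) ^ 2 = θ ^ 2 - A ^ 2 := by
      rw [hA1]
      field_simp
      rw [Real.cosh_sq]; ring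
    have f2 : κ ^ 2 / Real.sinh (κ * ℓ) ^ 2 = A ^ 2 - κ ^ 2 := by
      rw [hA2]
      field_simp
      rw [Real.cosh_sq]; ring
    rw [f1, f2, ← e1, ← e2]
    ring
  have bound : ∀ z s : ℝ, 0 < z → A - 1 / ℓ ≤ z → (z * ℓ) ^ 2 / 2 ≤ s →
      z ^ 2 / s ^ 2 ≤ 4 / ℓ ^ 4 * ((A - 1 / ℓ) ^ 2)⁻¹ := by
    intro z s hz hAz hs
    have h1 : z ^ 2 / s ^ 2 ≤ z ^ 2 / ((z * ℓ) ^ 2 / 2) ^ 2 := by gcongr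
    have h2 : z ^ 2 / ((z * ℓ) ^ 2 / 2) ^ 2 = 4 / ℓ ^ 4 * (z ^ 2)⁻¹ := by
      field_simp
      norm_num
    rw [h2] at h1
    refine h1.trans ?_
    gcongr
  have b1 := bound θ _ hθ (by linarith [show 0 < 1 / ℓ by positivity])
    ((sq_half_le_sinh hθℓ.le).trans hlt1.le)
  have b2 := bound κ _ hκ hκA (sq_half_le_sinh hκℓ.le)
  rw [hgap]
  calc _ ≤ _ := add_le_add b1 b2
    _ = _ := by ring

/-! ### Continuous functions on compactly carried measures -/

/-- The measure is carried by a compact set. -/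
def CompactlyCarried {X : Type*} [TopologicalSpace X] [MeasurableSpace X] (μ : Measure X) : Prop :=
  ∃ K, IsCompact K ∧ μ.restrict K = μ

section Carried

set_option linter.unusedSectionVars false

variable {X Y : Type*} [TopologicalSpace X] [MeasurableSpace X] [BorelSpace X]
  [SecondCountableTopology X] [T2Space X] [TopologicalSpace Y] [MeasurableSpace Y] [BorelSpace Y]
  [SecondCountableTopology Y] [T2Space Y] {μ : Measure X} {ν : Measure Y} [IsFiniteMeasure μ]
  [IsFiniteMeasure ν]

/-- Continuous functions are bounded on the carrying compact set. This discharges all integrability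
conditions for smooth functions on the box, its faces and its slices. -/
lemma CompactlyCarried.memLp (hμ : CompactlyCarried μ) {f : X → ℝ} (hf : Continuous f)
    (p : ENNReal) : MemLp f p μ := by
  obtain ⟨K, hK, hr⟩ := hμ
  obtain ⟨C, hC⟩ := hK.exists_bound_of_continuousOn hf.continuousOn
  refine MemLp.of_bound hf.aestronglyMeasurable C ?_
  rw [← hr]
  exact (ae_restrict_iff' hK.measurableSet).2 (Eventually.of_forall hC)

lemma CompactlyCarried.integrable (hμ : CompactlyCarried μ) {f : X → ℝ} (hf : Continuous f) :
    Integrable f μ := memLp_one_iff_integrable.1 (hμ.memLp hf 1)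

lemma CompactlyCarried.integral_sub_mul_sq (hμ : CompactlyCarried μ) {f g : X → ℝ}
    (hf : Continuous f) (hg : Continuous g) (r : ℝ) :
    ∫ x, (f x - r * g x) ^ 2 ∂μ =
      (∫ x, f x ^ 2 ∂μ) - 2 * r * (∫ x, f x * g x ∂μ) + r ^ 2 * ∫ x, g x ^ 2 ∂μ := by
  rw [← integral_const_mul, ← integral_const_mul,
    ← integral_sub (hμ.integrable (by fun_prop)) (hμ.integrable (by fun_prop)),
    ← integral_add (hμ.integrable (by fun_prop)) (hμ.integrable (by fun_prop))]
  congr 1; ext x; ring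

/-- Bessel's inequality for one unit vector: expand the square of the residual. -/
lemma CompactlyCarried.sq_integral_mul_le (hμ : CompactlyCarried μ) {f g : X → ℝ}
    (hf : Continuous f) (hg : Continuous g) (hg1 : ∫ x, g x ^ 2 ∂μ = 1) :
    (∫ x, f x * g x ∂μ) ^ 2 ≤ ∫ x, f x ^ 2 ∂μ := by
  have h1 : 0 ≤ ∫ x, (f x - (∫ x, f x * g x ∂μ) * g x) ^ 2 ∂μ :=
    integral_nonneg fun x => sq_nonneg _
  rw [hμ.integral_sub_mul_sq hf hg, hg1] at h1
  linarith

lemma CompactlyCarried.prod (hμ : CompactlyCarried μ) (hν : CompactlyCarried ν) :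
    CompactlyCarried (μ.prod ν) := by
  obtain ⟨K, hK, hr⟩ := hμ
  obtain ⟨L, hL, hs⟩ := hν
  exact ⟨K ×ˢ L, hK.prod hL, by rw [← Measure.prod_restrict, hr, hs]⟩

lemma CompactlyCarried.continuous_integral [LocallyCompactSpace X] (hν : CompactlyCarried ν)
    {f : X → Y → ℝ} (hf : Continuous (Function.uncurry f)) :
    Continuous fun x => ∫ y, f x y ∂ν := by
  obtain ⟨L, hL, hs⟩ := hν
  rw [← hs]
  exact continuous_parametric_integral_of_continuous hf hL

lemma CompactlyCarried.integral_swap (hμ : CompactlyCarried μ) (hν : CompactlyCarried ν)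
    {f : X → Y → ℝ} (hf : Continuous (Function.uncurry f)) :
    ∫ x, ∫ y, f x y ∂ν ∂μ = ∫ y, ∫ x, f x y ∂μ ∂ν :=
  integral_integral_swap ((hμ.prod hν).integrable hf)

/-- Tensorization of the variance for two factors. -/
lemma CompactlyCarried.tensorization [LocallyCompactSpace X] [LocallyCompactSpace Y]
    (hμ : CompactlyCarried μ) (hν : CompactlyCarried ν) {f : X → Y → ℝ}
    (hf : Continuous (Function.uncurry f)) {p : X → ℝ} {q : Y → ℝ} (hp : Continuous p)
    (hq : Continuous q) (hp1 : ∫ x, p x ^ 2 ∂μ = 1) (hq1 : ∫ y, q y ^ 2 ∂ν = 1) :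
    (∫ x, (∫ y, f x y * q y ∂ν) ^ 2 ∂μ) + ∫ y, (∫ x, f x y * p x ∂μ) ^ 2 ∂ν ≤
      (∫ x, ∫ y, f x y ^ 2 ∂ν ∂μ) + (∫ x, p x * ∫ y, f x y * q y ∂ν ∂μ) ^ 2 := by
  have hfs : Continuous fun z : Y × X => f z.2 z.1 := hf.comp continuous_swap
  have hf' : Continuous fun z : X × Y => f z.1 z.2 := hf
  set P : Y → ℝ := fun y => ∫ x, f x y * p x ∂μ with hP
  set R : X → ℝ := fun x => ∫ y, f x y * q y ∂ν with hR
  have hPc : Continuous P := hμ.continuous_integral (f := fun y x => f x y * p x)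
    (hfs.mul (hp.comp continuous_snd))
  have hRc : Continuous R := hν.continuous_integral (f := fun x y => f x y * q y)
    (hf.mul (hq.comp continuous_snd))
  have hSc : Continuous fun x => ∫ y, f x y ^ 2 ∂ν := hν.continuous_integral
    (f := fun x y => f x y ^ 2) (hf.pow 2)
  have hTc : Continuous fun x => ∫ y, f x y * P y ∂ν := hν.continuous_integral
    (f := fun x y => f x y * P y) (hf.mul (hPc.comp continuous_snd))
  set c := ∫ x, p x * R x ∂μ with hc
  have hfx : ∀ x, Continuous (f x) := fun x => hf.comp (Continuous.prodMk_right x)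
  have e1 : ∫ y, P y * q y ∂ν = c := by
    have : ∀ y, P y * q y = ∫ x, f x y * p x * q y ∂μ := fun y => by rw [integral_mul_const]
    simp_rw [this]
    rw [← hμ.integral_swap hν (f := fun x y => f x y * p x * q y)
      ((hf.mul (hp.comp continuous_fst)).mul (hq.comp continuous_snd)), hc]
    congr 1; ext x
    rw [← integral_const_mul]
    congr 1; ext y; ring
  have e2 : ∫ x, p x * ∫ y, f x y * P y ∂ν ∂μ = ∫ y, P y ^ 2 ∂ν := by
    have : ∀ x, p x * ∫ y, f x y * P y ∂ν = ∫ y, f x y * p x * P y ∂ν := fun x => by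
      rw [← integral_const_mul]
      congr 1; ext y; ring
    simp_rw [this]
    rw [hμ.integral_swap hν (f := fun x y => f x y * p x * P y)
      ((hf.mul (hp.comp continuous_fst)).mul (hPc.comp continuous_snd))]
    congr 1; ext y
    rw [integral_mul_const, sq]
  -- For fixed `x`, this is Bessel's inequality in direction `q` for `f x - p x • P`. Integrated
  -- over `x` it becomes `‖R‖² - c² ≤ ‖f‖² - ‖P‖²`.
  have step : ∀ x, R x ^ 2 - 2 * c * (p x * R x) + c ^ 2 * p x ^ 2 ≤
      (∫ y, f x y ^ 2 ∂ν) - 2 * (p x * ∫ y, f x y * P y ∂ν) + p x ^ 2 * ∫ y, P y ^ 2 ∂ν := by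
    intro x
    have hfx := hfx x
    have g1 := hν.sq_integral_mul_le (f := fun y => f x y - p x * P y) (by fun_prop) hq hq1
    have g2 : ∫ y, (f x y - p x * P y) * q y ∂ν = R x - p x * c := by
      rw [← e1, ← integral_const_mul,
        ← integral_sub (hν.integrable (by fun_prop)) (hν.integrable (by fun_prop))]
      congr 1; ext y; ring
    rw [g2, hν.integral_sub_mul_sq hfx hPc] at g1
    linarith
  have fin := integral_mono (μ := μ) (hμ.integrable (by fun_prop)) (hμ.integrable (by fun_prop))
    step
  rw [integral_add (hμ.integrable (by fun_prop)) (hμ.integrable (by fun_prop)),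
    integral_sub (hμ.integrable (by fun_prop)) (hμ.integrable (by fun_prop)),
    integral_add (hμ.integrable (by fun_prop)) (hμ.integrable (by fun_prop)),
    integral_sub (hμ.integrable (by fun_prop)) (hμ.integrable (by fun_prop)),
    integral_const_mul, integral_const_mul, integral_const_mul, integral_mul_const, e2, hp1] at fin
  linarith

end Carried

/-! ### The energy inequality on an interval -/

lemma integral_Ioo_eq {a b : ℝ} (hab : a < b) (f : ℝ → ℝ) :
    ∫ x in Set.Ioo a b, f x = ∫ x in a..b, f x := by
  rw [intervalIntegral.integral_of_le hab.le, integral_Ioc_eq_integral_Ioo]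

lemma integral_eq_add_halves (a b : ℝ) {f : ℝ → ℝ} (hf : Continuous f) :
    ∫ x in a..b, f x = (∫ x in (0 : ℝ)..(b - a) / 2, f ((a + b) / 2 + x)) +
      ∫ x in (0 : ℝ)..(b - a) / 2, f ((a + b) / 2 - x) := by
  rw [intervalIntegral.integral_comp_add_left, intervalIntegral.integral_comp_sub_left]
  have e1 : (a + b) / 2 + (b - a) / 2 = b := by ring
  have e2 : (a + b) / 2 - (b - a) / 2 = a := by ring
  rw [e1, e2, add_zero, sub_zero, add_comm]
  exact (intervalIntegral.integral_add_adjacent_intervals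
    (hf.intervalIntegrable _ _) (hf.intervalIntegrable _ _)).symm

/-- The Robin energy on the interval `(a, b)`. -/
noncomputable def energy (a b α : ℝ) (f : ℝ → ℝ) : ℝ :=
  (∫ x in Set.Ioo a b, deriv f x ^ 2) + α * (f a ^ 2 + f b ^ 2)

lemma energy_eq_add_halves {a b : ℝ} (hab : a < b) (α : ℝ) {f : ℝ → ℝ} (hf : ContDiff ℝ ∞ f) :
    energy a b α f = halfEnergy ((b - a) / 2) α (fun x => f ((a + b) / 2 + x)) +
      halfEnergy ((b - a) / 2) α (fun x => f ((a + b) / 2 - x)) := by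
  have := (smooth_deriv hf).continuous
  unfold energy halfEnergy
  rw [integral_Ioo_eq hab, integral_eq_add_halves a b (by fun_prop)]
  have e1 : (a + b) / 2 + (b - a) / 2 = b := by ring
  have e2 : (a + b) / 2 - (b - a) / 2 = a := by ring
  simp_rw [deriv_comp_const_add, deriv_comp_const_sub, e1, e2, neg_sq]
  ring

/-- `χ` is a unit vector such that the energy on `(a, b)` is at least `lam` on its span, and at
least `lam + g` on its orthogonal complement. -/
structure IsGroundState (a b α lam g : ℝ) (χ : ℝ → ℝ) : Prop where
  continuous : Continuous χ
  norm : ∫ x in Set.Ioo a b, χ x ^ 2 = 1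
  bound : ∀ f : ℝ → ℝ, ContDiff ℝ ∞ f →
    (lam * ∫ x in Set.Ioo a b, f x ^ 2) +
      g * ((∫ x in Set.Ioo a b, f x ^ 2) - (∫ x in Set.Ioo a b, f x * χ x) ^ 2) ≤ energy a b α f

lemma compactlyCarried_Ioo (a b : ℝ) :
    CompactlyCarried ((volume : Measure ℝ).restrict (Set.Ioo a b)) :=
  ⟨Set.Icc a b, isCompact_Icc, by
    rw [Measure.restrict_restrict measurableSet_Icc,
      Set.inter_eq_self_of_subset_right Set.Ioo_subset_Icc_self]⟩

/-- The factor of `g` is nonnegative by Bessel. This allows the minimal gap to be used in every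
coordinate, as tensorization requires. -/
lemma IsGroundState.mono {a b α lam g g' : ℝ} {χ : ℝ → ℝ} (h : IsGroundState a b α lam g χ)
    (hg : g' ≤ g) : IsGroundState a b α lam g' χ where
  continuous := h.continuous
  norm := h.norm
  bound f hf := by
    refine le_trans ?_ (h.bound f hf)
    have hc := h.continuous
    have hfc := hf.continuous
    have : 0 ≤ (∫ x in Set.Ioo a b, f x ^ 2) - (∫ x in Set.Ioo a b, f x * χ x) ^ 2 := by
      exact sub_nonneg.2 ((compactlyCarried_Ioo a b).sq_integral_mul_le hfc hc h.norm)
    have := mul_le_mul_of_nonneg_right hg this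
    linarith

/-- The even state, moved to the interval `(a, b)` and normalized. -/
noncomputable def normalizedState (a b : ℝ) (φ : ℝ → ℝ) (x : ℝ) : ℝ :=
  (√(∫ y in Set.Ioo a b, φ (y - (a + b) / 2) ^ 2))⁻¹ * φ (x - (a + b) / 2)

lemma contDiff_comp_sub {φ : ℝ → ℝ} (hφ : ContDiff ℝ ∞ φ) (c : ℝ) :
    ContDiff ℝ ∞ fun x => φ (x - c) := hφ.comp (contDiff_id.sub contDiff_const)

lemma integral_translate_halves {a b : ℝ} (hab : a < b) {φ : ℝ → ℝ} (hφ : Continuous φ)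
    (h : ∀ x, φ (-x) ^ 2 = φ x ^ 2) :
    ∫ y in Set.Ioo a b, φ (y - (a + b) / 2) ^ 2 =
      2 * ∫ x in (0 : ℝ)..(b - a) / 2, φ x ^ 2 := by
  rw [integral_Ioo_eq hab, integral_eq_add_halves a b (by fun_prop)]
  have e1 : ∀ x, (a + b) / 2 + x - (a + b) / 2 = x := fun x => by ring
  have e2 : ∀ x, (a + b) / 2 - x - (a + b) / 2 = -x := fun x => by ring
  simp_rw [e1, e2, h]
  ring

lemma IsEvenState.isGroundState {a b α lam mu : ℝ} {φ ψ : ℝ → ℝ} (hab : a < b)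
    (h : IsEvenState ((b - a) / 2) α lam φ) (h' : IsOddState ((b - a) / 2) α mu ψ) :
    IsGroundState a b α lam (mu - lam) (normalizedState a b φ) := by
  have hℓ : 0 < (b - a) / 2 := by linarith
  have hφc := h.smooth.continuous
  set N := ∫ y in Set.Ioo a b, φ (y - (a + b) / 2) ^ 2 with hN
  have hN2 : N = 2 * ∫ x in (0 : ℝ)..(b - a) / 2, φ x ^ 2 :=
    integral_translate_halves hab hφc fun x => by rw [h.even]
  have hNpos : 0 < N := by
    have := integral_mul_pos hℓ hφc hφc h.pos' h.pos'
    simp_rw [← sq] at this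
    linarith
  refine ⟨?_, ?_, fun f hf => ?_⟩
  · unfold normalizedState
    fun_prop
  · unfold normalizedState
    simp_rw [mul_pow]
    rw [integral_const_mul, ← hN, inv_pow, Real.sq_sqrt hNpos.le, inv_mul_cancel₀ hNpos.ne']
  · have hfc := hf.continuous
    have h0 := (h.pos 0 ⟨le_rfl, hℓ.le⟩).ne'
    -- Both halves of `f` have the same value at the midpoint, so the same multiple of `φ` makes
    -- both vanish there.
    set k := f ((a + b) / 2) / φ 0 with hk
    have hk' : f ((a + b) / 2) = k * φ 0 := by rw [hk]; field_simp
    have b1 := le_halfEnergy_of_states hℓ h h' (f := fun x => f ((a + b) / 2 + x)) (k := k)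
      (hf.comp (contDiff_const.add contDiff_id)) (by simpa using hk')
    have b2 := le_halfEnergy_of_states hℓ h h' (f := fun x => f ((a + b) / 2 - x)) (k := k)
      (hf.comp (contDiff_const.sub contDiff_id)) (by simpa using hk')
    rw [energy_eq_add_halves hab α hf]
    have e1 : ∀ x, (a + b) / 2 + x - (a + b) / 2 = x := fun x => by ring
    have e2 : ∀ x, (a + b) / 2 - x - (a + b) / 2 = -x := fun x => by ring
    have i1 : ∫ x in Set.Ioo a b, f x ^ 2 =
        (∫ x in (0 : ℝ)..(b - a) / 2, f ((a + b) / 2 + x) ^ 2) +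
          ∫ x in (0 : ℝ)..(b - a) / 2, f ((a + b) / 2 - x) ^ 2 := by
      rw [integral_Ioo_eq hab, integral_eq_add_halves a b (by fun_prop)]
    have i2 : ∫ x in Set.Ioo a b, f x * φ (x - (a + b) / 2) =
        (∫ x in (0 : ℝ)..(b - a) / 2, f ((a + b) / 2 + x) * φ x) +
          ∫ x in (0 : ℝ)..(b - a) / 2, f ((a + b) / 2 - x) * φ x := by
      rw [integral_Ioo_eq hab, integral_eq_add_halves a b (by fun_prop)]
      simp_rw [e1, e2, h.even]
    have i3 : (∫ x in Set.Ioo a b, f x * normalizedState a b φ x) ^ 2 =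
        (∫ x in Set.Ioo a b, f x * φ (x - (a + b) / 2)) ^ 2 / N := by
      unfold normalizedState
      simp_rw [← hN, mul_left_comm (f _)]
      rw [integral_const_mul, mul_pow, inv_pow, Real.sq_sqrt hNpos.le]
      exact (div_eq_inv_mul _ _).symm
    rw [i3, i2, i1]
    set A := ∫ x in (0 : ℝ)..(b - a) / 2, f ((a + b) / 2 + x) ^ 2
    set B := ∫ x in (0 : ℝ)..(b - a) / 2, f ((a + b) / 2 - x) ^ 2
    set C := ∫ x in (0 : ℝ)..(b - a) / 2, f ((a + b) / 2 + x) * φ x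
    set D := ∫ x in (0 : ℝ)..(b - a) / 2, f ((a + b) / 2 - x) * φ x
    -- The given `k` need not be optimal; the quadratic in `k` is bounded by its maximum, at `k = (C
    -- + D) / N`, which is the squared projection onto `φ`.
    have hsq : 2 * k * (C + D) - k ^ 2 * N ≤ (C + D) ^ 2 / N := by
      rw [le_div_iff₀ hNpos]
      nlinarith [sq_nonneg (C + D - k * N)]
    have := mul_le_mul_of_nonneg_left hsq (sub_pos.2 (h.lt_of_isOddState hℓ h')).le
    rw [hN2] at this hsq ⊢
    linarith

/-! ### Integration over the box and its boundary, by slices -/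

lemma compactlyCarried_pi {n : ℕ} {μ : Fin n → Measure ℝ} [∀ i, IsFiniteMeasure (μ i)]
    (h : ∀ i, CompactlyCarried (μ i)) : CompactlyCarried (Measure.pi μ) := by
  choose K hK hr using h
  exact ⟨Set.univ.pi K, isCompact_univ_pi hK, by rw [Measure.restrict_pi_pi]; simp_rw [hr]⟩

lemma CompactlyCarried.add {X : Type*} [TopologicalSpace X] [MeasurableSpace X] [T2Space X]
    [OpensMeasurableSpace X] {μ ν : Measure X}
    (hμ : CompactlyCarried μ) (hν : CompactlyCarried ν) : CompactlyCarried (μ + ν) := by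
  obtain ⟨K, hK, hr⟩ := hμ
  obtain ⟨L, hL, hs⟩ := hν
  refine ⟨K ∪ L, hK.union hL, ?_⟩
  rw [Measure.restrict_add]
  congr 1
  · conv_lhs => rw [← hr]
    rw [Measure.restrict_restrict (hK.union hL).measurableSet, Set.inter_eq_self_of_subset_right
      Set.subset_union_left, hr]
  · conv_lhs => rw [← hs]
    rw [Measure.restrict_restrict (hK.union hL).measurableSet, Set.inter_eq_self_of_subset_right
      Set.subset_union_right, hs]

lemma CompactlyCarried.sum {X : Type*} [TopologicalSpace X] [MeasurableSpace X] [T2Space X]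
    [OpensMeasurableSpace X] {ι : Type*} (s : Finset ι) {μ : ι → Measure X}
    (hμ : ∀ i, CompactlyCarried (μ i)) : CompactlyCarried (∑ i ∈ s, μ i) := by
  classical
  induction s using Finset.induction_on with
  | empty => exact ⟨∅, isCompact_empty, by simp⟩
  | insert i s hi ih =>
    rw [Finset.sum_insert hi]
    exact (hμ i).add ih

lemma compactlyCarried_dirac (c : ℝ) : CompactlyCarried (Measure.dirac c) :=
  ⟨{c}, isCompact_singleton, by rw [restrict_dirac, if_pos (Set.mem_singleton c)]⟩

/-! ### The measures of the box and of its boundary. -/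

section Box

variable {n : ℕ} (a b : Fin n → ℝ)

lemma boxMeasure_eq_pi :
    boxMeasure a b = Measure.pi fun i => (volume : Measure ℝ).restrict (Set.Ioo (a i) (b i)) := by
  unfold boxMeasure box
  rw [volume_pi, Measure.restrict_pi_pi]

instance : IsFiniteMeasure (boxMeasure a b) := by
  rw [boxMeasure_eq_pi]
  infer_instance

lemma compactlyCarried_boxMeasure : CompactlyCarried (boxMeasure a b) := by
  rw [boxMeasure_eq_pi]
  exact compactlyCarried_pi fun i => compactlyCarried_Ioo _ _

instance (i j : Fin n) (c : ℝ) : IsFiniteMeasure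
    (if i = j then Measure.dirac c else (volume : Measure ℝ).restrict (Set.Ioo (a i) (b i))) := by
  split_ifs <;> infer_instance

instance (j : Fin n) (c : ℝ) : IsFiniteMeasure (faceMeasure a b j c) := by
  unfold faceMeasure
  infer_instance

lemma compactlyCarried_faceMeasure (j : Fin n) (c : ℝ) :
    CompactlyCarried (faceMeasure a b j c) := by
  refine compactlyCarried_pi fun i => ?_
  split_ifs
  exacts [compactlyCarried_dirac c, compactlyCarried_Ioo _ _]

instance : IsFiniteMeasure (boundaryMeasure a b) := by
  unfold boundaryMeasure
  infer_instance

lemma compactlyCarried_boundaryMeasure : CompactlyCarried (boundaryMeasure a b) :=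
  CompactlyCarried.sum _ fun j =>
    (compactlyCarried_faceMeasure a b j _).add (compactlyCarried_faceMeasure a b j _)

lemma integral_boundaryMeasure {f : (Fin n → ℝ) → ℝ} (hf : Continuous f) :
    ∫ x, f x ∂boundaryMeasure a b =
      ∑ j, ((∫ x, f x ∂faceMeasure a b j (a j)) + ∫ x, f x ∂faceMeasure a b j (b j)) := by
  have h : ∀ j c, Integrable f (faceMeasure a b j c) := fun j c =>
    (compactlyCarried_faceMeasure a b j c).integrable hf
  unfold boundaryMeasure
  rw [integral_finsetSum_measure fun j _ => (h j _).add_measure (h j _)]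
  exact Finset.sum_congr rfl fun j _ => integral_add_measure (h j _) (h j _)

end Box

/-- The point of `ℝⁿ⁺¹` with first coordinate `t` and remaining coordinates `y`. -/
def consPt {n : ℕ} (t : ℝ) (y : Fin n → ℝ) : Fin (n + 1) → ℝ := Fin.cons t y

lemma contDiff_consPt {n : ℕ} : ContDiff ℝ ∞ fun z : ℝ × (Fin n → ℝ) => consPt z.1 z.2 := by
  rw [contDiff_pi]
  intro i
  refine Fin.cases ?_ (fun j => ?_) i
  · exact contDiff_fst
  · exact (contDiff_apply ℝ ℝ j).comp contDiff_snd

lemma continuous_consPt {n : ℕ} : Continuous fun z : ℝ × (Fin n → ℝ) => consPt z.1 z.2 :=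
  contDiff_consPt.continuous

lemma integral_pi_succ {n : ℕ} {μ : Fin (n + 1) → Measure ℝ} [∀ i, IsFiniteMeasure (μ i)]
    (h : ∀ i, CompactlyCarried (μ i)) {f : (Fin (n + 1) → ℝ) → ℝ} (hf : Continuous f) :
    ∫ x, f x ∂Measure.pi μ = ∫ t, ∫ y, f (consPt t y) ∂Measure.pi (fun j => μ j.succ) ∂μ 0 := by
  have h1 := ((measurePreserving_piFinSuccAbove μ 0).symm).integral_comp' f
  rw [← h1]
  have h2 : ∀ z : ℝ × (Fin n → ℝ),
      (MeasurableEquiv.piFinSuccAbove (fun _ : Fin (n + 1) => ℝ) 0).symm z = consPt z.1 z.2 := by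
    intro z
    exact Fin.insertNth_zero' z.1 z.2
  simp_rw [h2, Fin.succAbove_zero]
  exact integral_prod _ (((h 0).prod (compactlyCarried_pi fun j => h j.succ)).integrable
    (hf.comp continuous_consPt))

/-! ### Fubini and derivatives along the first coordinate. -/

section Slices

variable {n : ℕ} (a b : Fin (n + 1) → ℝ) {f : (Fin (n + 1) → ℝ) → ℝ}

lemma integral_boxMeasure_succ (hf : Continuous f) :
    ∫ x, f x ∂boxMeasure a b =
      ∫ t in Set.Ioo (a 0) (b 0), ∫ y, f (consPt t y) ∂boxMeasure (Fin.tail a) (Fin.tail b) := by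
  rw [boxMeasure_eq_pi, boxMeasure_eq_pi, integral_pi_succ (fun i => compactlyCarried_Ioo _ _) hf]
  rfl

lemma integral_faceMeasure_zero (c : ℝ) (hf : Continuous f) :
    ∫ x, f x ∂faceMeasure a b 0 c =
      ∫ y, f (consPt c y) ∂boxMeasure (Fin.tail a) (Fin.tail b) := by
  rw [boxMeasure_eq_pi, faceMeasure, integral_pi_succ _ hf]
  · simp only [↓reduceIte, Fin.succ_ne_zero]
    rw [integral_dirac]
    rfl
  · intro i
    split_ifs
    exacts [compactlyCarried_dirac c, compactlyCarried_Ioo _ _]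

lemma integral_faceMeasure_succ (j : Fin n) (c : ℝ) (hf : Continuous f) :
    ∫ x, f x ∂faceMeasure a b j.succ c =
      ∫ t in Set.Ioo (a 0) (b 0),
        ∫ y, f (consPt t y) ∂faceMeasure (Fin.tail a) (Fin.tail b) j c := by
  rw [faceMeasure, integral_pi_succ _ hf]
  · simp only [(Fin.succ_ne_zero j).symm, if_false, Fin.succ_inj]
    rfl
  · intro i
    split_ifs
    exacts [compactlyCarried_dirac c, compactlyCarried_Ioo _ _]

lemma continuous_slice (hf : Continuous f) :
    Continuous (Function.uncurry fun t y => f (consPt t y)) := hf.comp continuous_consPt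

lemma continuous_slice_right (hf : Continuous f) (t : ℝ) :
    Continuous fun y => f (consPt t y) :=
  hf.comp (continuous_consPt.comp (Continuous.prodMk_right t))

/-- The two faces orthogonal to the first axis are copies of the lower-dimensional box; every other
face is an interval times a face of that box. -/
lemma integral_boundaryMeasure_succ (hf : Continuous f) :
    ∫ x, f x ∂boundaryMeasure a b =
      (∫ y, f (consPt (a 0) y) ∂boxMeasure (Fin.tail a) (Fin.tail b)) +
      (∫ y, f (consPt (b 0) y) ∂boxMeasure (Fin.tail a) (Fin.tail b)) +
      ∫ t in Set.Ioo (a 0) (b 0),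
        ∫ y, f (consPt t y) ∂boundaryMeasure (Fin.tail a) (Fin.tail b) := by
  have hi : ∀ j c, IntegrableOn
      (fun t => ∫ y, f (consPt t y) ∂faceMeasure (Fin.tail a) (Fin.tail b) j c)
      (Set.Ioo (a 0) (b 0)) := fun j c =>
    (compactlyCarried_Ioo _ _).integrable
      ((compactlyCarried_faceMeasure _ _ j c).continuous_integral (continuous_slice hf))
  rw [integral_boundaryMeasure a b hf, Fin.sum_univ_succ, integral_faceMeasure_zero a b _ hf,
    integral_faceMeasure_zero a b _ hf]
  congr 1
  simp_rw [integral_boundaryMeasure (Fin.tail a) (Fin.tail b) (continuous_slice_right hf _)]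
  rw [integral_finsetSum]
  · refine Finset.sum_congr rfl fun j _ => ?_
    rw [integral_faceMeasure_succ a b j _ hf, integral_faceMeasure_succ a b j _ hf]
    exact (integral_add (hi j _) (hi j _)).symm
  · exact fun j _ => (hi j _).add (hi j _)

lemma partialDeriv_eq_deriv {m : ℕ} {g : (Fin m → ℝ) → ℝ} (hg : ContDiff ℝ ∞ g) (j : Fin m)
    (x : Fin m → ℝ) : partialDeriv j g x = deriv (fun s : ℝ => g (x + s • Pi.single j 1)) 0 :=
  ((hg.differentiable (by simp)).differentiableAt.lineDeriv_eq_fderiv).symm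

lemma continuous_partialDeriv {m : ℕ} {g : (Fin m → ℝ) → ℝ} (hg : ContDiff ℝ ∞ g) (j : Fin m) :
    Continuous (partialDeriv j g) :=
  (hg.continuous_fderiv (by simp)).clm_apply continuous_const

lemma contDiff_slice_right (hf : ContDiff ℝ ∞ f) (t : ℝ) : ContDiff ℝ ∞ fun y => f (consPt t y) :=
  hf.comp (contDiff_consPt.comp (contDiff_prodMk_right t))

lemma contDiff_slice_left (hf : ContDiff ℝ ∞ f) (y : Fin n → ℝ) :
    ContDiff ℝ ∞ fun t => f (consPt t y) :=
  hf.comp (contDiff_consPt.comp (contDiff_prodMk_left y))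

lemma partialDeriv_slice_succ (hf : ContDiff ℝ ∞ f) (j : Fin n) (t : ℝ) (y : Fin n → ℝ) :
    partialDeriv j (fun y => f (consPt t y)) y = partialDeriv j.succ f (consPt t y) := by
  rw [partialDeriv_eq_deriv (contDiff_slice_right hf t), partialDeriv_eq_deriv hf]
  congr 1; ext s; congr 1; ext i
  refine Fin.cases ?_ (fun k => ?_) i
  · simp [consPt]
  · simp [consPt, Pi.single_apply]

lemma deriv_slice_zero (hf : ContDiff ℝ ∞ f) (t : ℝ) (y : Fin n → ℝ) :
    deriv (fun t => f (consPt t y)) t = partialDeriv 0 f (consPt t y) := by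
  have h1 : (fun s : ℝ => f (consPt t y + s • Pi.single 0 1)) =
      fun s => f (consPt (t + s) y) := by
    ext s; congr 1; ext i
    refine Fin.cases ?_ (fun k => ?_) i
    · simp [consPt]
    · simp [consPt]
  rw [partialDeriv_eq_deriv hf, h1, deriv_comp_const_add (fun t => f (consPt t y)) t 0, add_zero]

end Slices

/-! ### The energy inequality on the box -/

/-- The Robin energy of a smooth function on the box. -/
noncomputable def boxEnergy {n : ℕ} (a b : Fin n → ℝ) (α : ℝ) (f : (Fin n → ℝ) → ℝ) : ℝ :=
  (∑ j, ∫ x, partialDeriv j f x ^ 2 ∂boxMeasure a b) + α * ∫ x, f x ^ 2 ∂boundaryMeasure a b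

/-- Additivity of the energy under products: the faces orthogonal to the first axis supply the
endpoint terms of the one-dimensional energy, and the others the boundary terms of the slices. -/
lemma boxEnergy_succ {n : ℕ} (a b : Fin (n + 1) → ℝ) (α : ℝ) {f : (Fin (n + 1) → ℝ) → ℝ}
    (hf : ContDiff ℝ ∞ f) :
    boxEnergy a b α f =
      (∫ y, energy (a 0) (b 0) α (fun t => f (consPt t y)) ∂boxMeasure (Fin.tail a) (Fin.tail b)) +
      ∫ t in Set.Ioo (a 0) (b 0), boxEnergy (Fin.tail a) (Fin.tail b) α fun y => f (consPt t y) := by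
  set ν := boxMeasure (Fin.tail a) (Fin.tail b) with hν
  have cν : CompactlyCarried ν := compactlyCarried_boxMeasure _ _
  have cμ := compactlyCarried_Ioo (a 0) (b 0)
  have cβ := compactlyCarried_boundaryMeasure (Fin.tail a) (Fin.tail b)
  have hc : Continuous fun x => f x ^ 2 := hf.continuous.pow 2
  have hd : ∀ j, Continuous fun x => partialDeriv j f x ^ 2 := fun j =>
    (continuous_partialDeriv hf j).pow 2
  have c0 := cμ.continuous_integral (f := fun y t => partialDeriv 0 f (consPt t y) ^ 2)
    ((continuous_slice (hd 0)).comp continuous_swap)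
  have cj : ∀ j : Fin n, Continuous fun t => ∫ y, partialDeriv j.succ f (consPt t y) ^ 2 ∂ν :=
    fun j => cν.continuous_integral (continuous_slice (hd j.succ))
  have cb := cβ.continuous_integral (continuous_slice hc)
  have ca := fun t => continuous_slice_right hc t
  unfold boxEnergy energy
  simp_rw [deriv_slice_zero hf, partialDeriv_slice_succ hf]
  rw [integral_boundaryMeasure_succ a b hc, Fin.sum_univ_succ,
    integral_add (cν.integrable c0) (cν.integrable (by have := ca (a 0); have := ca (b 0); fun_prop)),
    integral_const_mul, integral_add (cν.integrable (ca _)) (cν.integrable (ca _)),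
    integral_add (cμ.integrable (continuous_finsetSum _ fun j _ => cj j))
      (cμ.integrable (cb.const_mul _)), integral_const_mul,
    integral_finsetSum _ (fun j _ => cμ.integrable (cj j)),
    integral_boxMeasure_succ a b (hd 0), cμ.integral_swap cν (continuous_slice (hd 0))]
  simp_rw [integral_boxMeasure_succ a b (hd _)]
  ring

lemma contDiff_prod_coord {n : ℕ} {χ : Fin n → ℝ → ℝ} (h : ∀ i, ContDiff ℝ ∞ (χ i)) :
    ContDiff ℝ ∞ fun x : Fin n → ℝ => ∏ i, χ i (x i) :=
  contDiff_prod fun i _ => (h i).comp (contDiff_apply ℝ ℝ i)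

lemma continuous_prod_coord {n : ℕ} {χ : Fin n → ℝ → ℝ} (h : ∀ i, Continuous (χ i)) :
    Continuous fun x : Fin n → ℝ => ∏ i, χ i (x i) :=
  continuous_finsetProd _ fun i _ => (h i).comp (continuous_apply i)

lemma integral_prod_sq {n : ℕ} (a b : Fin n → ℝ) (χ : Fin n → ℝ → ℝ) :
    ∫ x, (∏ i, χ i (x i)) ^ 2 ∂boxMeasure a b = ∏ i, ∫ t in Set.Ioo (a i) (b i), χ i t ^ 2 := by
  rw [boxMeasure_eq_pi, ← integral_fintype_prod_eq_prod]
  simp_rw [Finset.prod_pow]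

/-- The energy is at least `∑ lam` on the span of the product ground state, and at least
`∑ lam + g` on its orthogonal complement. -/
theorem le_boxEnergy {n : ℕ} {a b : Fin n → ℝ} {α g : ℝ} (hg : 0 ≤ g) {lam : Fin n → ℝ}
    {χ : Fin n → ℝ → ℝ} (h : ∀ i, IsGroundState (a i) (b i) α (lam i) g (χ i))
    {f : (Fin n → ℝ) → ℝ} (hf : ContDiff ℝ ∞ f) :
    ((∑ i, lam i) * ∫ x, f x ^ 2 ∂boxMeasure a b) +
      g * ((∫ x, f x ^ 2 ∂boxMeasure a b) -
        (∫ x, f x * ∏ i, χ i (x i) ∂boxMeasure a b) ^ 2) ≤ boxEnergy a b α f := by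
  induction n with
  | zero =>
    -- In dimension zero the box is a point, the empty product is `1` and the boundary is empty, so
    -- both sides are `0`.
    have hp : boxMeasure a b = Measure.dirac isEmptyElim := by
      rw [boxMeasure_eq_pi, Measure.pi_of_empty]
    have h0 : boundaryMeasure a b = 0 := by simp [boundaryMeasure]
    simp [boxEnergy, hp, h0]
  | succ n ih =>
    have ih' := fun t => ih (a := Fin.tail a) (b := Fin.tail b) (lam := Fin.tail lam)
      (χ := Fin.tail χ) (fun i => h i.succ) (contDiff_slice_right hf t)
    have h0 := fun y => (h 0).bound _ (contDiff_slice_left hf y)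
    set ν := boxMeasure (Fin.tail a) (Fin.tail b) with hν
    set q : (Fin n → ℝ) → ℝ := fun y => ∏ i, Fin.tail χ i (y i) with hq
    have hqc : Continuous q := continuous_prod_coord fun i => (h i.succ).continuous
    have hpc := (h 0).continuous
    have hq1 : ∫ y, q y ^ 2 ∂ν = 1 := by
      rw [hq, hν, integral_prod_sq]
      exact Finset.prod_eq_one fun i _ => (h i.succ).norm
    have cν : CompactlyCarried ν := compactlyCarried_boxMeasure _ _
    have cμ := compactlyCarried_Ioo (a 0) (b 0)
    have cβ := compactlyCarried_boundaryMeasure (Fin.tail a) (Fin.tail b)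
    have hfc := hf.continuous
    have hs := continuous_slice hfc
    have hs' : Continuous fun z : (Fin n → ℝ) × ℝ => f (consPt z.2 z.1) :=
      hs.comp continuous_swap
    have hc : Continuous fun x => f x ^ 2 := hfc.pow 2
    have hd : ∀ j, Continuous fun x => partialDeriv j f x ^ 2 := fun j =>
      (continuous_partialDeriv hf j).pow 2
    have c1 := cν.continuous_integral (f := fun t y => f (consPt t y) ^ 2)
      (continuous_slice hc)
    have c2 := cμ.continuous_integral (f := fun y t => f (consPt t y) ^ 2)
      ((continuous_slice hc).comp continuous_swap)
    have c3 := cν.continuous_integral (f := fun t y => f (consPt t y) * q y)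
      (hs.mul (hqc.comp continuous_snd))
    have c4 := cμ.continuous_integral (f := fun y t => f (consPt t y) * χ 0 t)
      (hs'.mul (hpc.comp continuous_snd))
    have c5 : Continuous fun y => energy (a 0) (b 0) α (fun t => f (consPt t y)) := by
      have := cμ.continuous_integral (f := fun y t => partialDeriv 0 f (consPt t y) ^ 2)
        ((continuous_slice (hd 0)).comp continuous_swap)
      unfold energy
      simp_rw [deriv_slice_zero hf]
      exact this.add (((continuous_slice_right hc _).add
        (continuous_slice_right hc _)).const_mul _)
    have c6 : Continuous fun t => boxEnergy (Fin.tail a) (Fin.tail b) α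
        fun y => f (consPt t y) := by
      unfold boxEnergy
      simp_rw [partialDeriv_slice_succ hf]
      exact (continuous_finsetSum _ fun (j : Fin n) _ => cν.continuous_integral
        (continuous_slice (hd j.succ))).add
          ((cβ.continuous_integral (continuous_slice hc)).const_mul _)
    have I1 := integral_mono (μ := ν)
      (cν.integrable ((c2.const_mul _).add ((c2.sub (c4.pow 2)).const_mul _)))
      (cν.integrable c5) h0
    have I2 := integral_mono (μ := (volume : Measure ℝ).restrict (Set.Ioo (a 0) (b 0)))
      (cμ.integrable ((c1.const_mul _).add ((c1.sub (c3.pow 2)).const_mul _)))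
      (cμ.integrable c6) ih'
    simp only [Pi.add_apply, Pi.sub_apply, Pi.pow_apply] at I1 I2
    rw [integral_add (cν.integrable (by fun_prop)) (cν.integrable (by fun_prop)),
      integral_const_mul, integral_const_mul,
      integral_sub (cν.integrable (by fun_prop)) (cν.integrable (by fun_prop)),
      ← cμ.integral_swap cν (continuous_slice hc)] at I1
    rw [integral_add (cμ.integrable (by fun_prop)) (cμ.integrable (by fun_prop)),
      integral_const_mul, integral_const_mul,
      integral_sub (cμ.integrable (by fun_prop)) (cμ.integrable (by fun_prop))] at I2
    -- The two slice estimates produce two variance terms with the same coefficient `g ≥ 0`;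
    -- tensorization bounds their sum below by `g` times the full variance.
    have T := mul_le_mul_of_nonneg_left
      (cμ.tensorization cν hs hpc hqc (h 0).norm hq1) hg
    have hfχ : ∫ x, f x * ∏ i, χ i (x i) ∂boxMeasure a b =
        ∫ t in Set.Ioo (a 0) (b 0), χ 0 t * ∫ y, f (consPt t y) * q y ∂ν := by
      rw [integral_boxMeasure_succ a b (f := fun x => f x * ∏ i, χ i (x i))
        (hfc.mul (continuous_prod_coord fun i => (h i).continuous))]
      congr 1; ext t
      rw [← integral_const_mul]
      congr 1; ext y
      rw [Fin.prod_univ_succ]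
      simp only [consPt, Fin.cons_zero, Fin.cons_succ, hq, Fin.tail]
      ring
    rw [boxEnergy_succ a b α hf, hfχ, integral_boxMeasure_succ a b hc, Fin.sum_univ_succ]
    have hsum : ∑ i, Fin.tail lam i = ∑ i : Fin n, lam i.succ := rfl
    rw [hsum] at I2
    linarith

/-! ### Lower bounds for the Robin eigenvalues -/

lemma tendsto_toLp {X : Type*} [MeasurableSpace X] {μ : Measure X} {f : ℕ → X → ℝ}
    (hf : ∀ m, MemLp (f m) 2 μ) {u : Lp ℝ 2 μ}
    (h : Tendsto (fun m => eLpNorm (fun x => f m x - u x) 2 μ) atTop (𝓝 0)) :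
    Tendsto (fun m => (hf m).toLp (f m)) atTop (𝓝 u) := by
  rw [Lp.tendsto_Lp_iff_tendsto_eLpNorm']
  refine h.congr fun m => eLpNorm_congr_ae ?_
  filter_upwards [(hf m).coeFn_toLp] with x hx
  simp [hx]

lemma inner_toLp {X : Type*} [MeasurableSpace X] {μ : Measure X} {f g : X → ℝ}
    (hf : MemLp f 2 μ) (hg : MemLp g 2 μ) :
    inner ℝ (hf.toLp f) (hg.toLp g) = ∫ x, f x * g x ∂μ := by
  rw [L2.inner_def]
  refine integral_congr_ae ?_
  filter_upwards [hf.coeFn_toLp, hg.coeFn_toLp] with x hx hy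
  rw [hx, hy]
  simp [mul_comm]

lemma norm_toLp_sq {X : Type*} [MeasurableSpace X] {μ : Measure X} {f : X → ℝ}
    (hf : MemLp f 2 μ) : ‖hf.toLp f‖ ^ 2 = ∫ x, f x ^ 2 ∂μ := by
  rw [← real_inner_self_eq_norm_sq, inner_toLp]
  simp_rw [sq]

/-! ### From smooth functions to `H¹`. -/

section H1

variable {n : ℕ} {a b : Fin n → ℝ}

lemma memLp_box {f : (Fin n → ℝ) → ℝ} (hf : Continuous f) (a b : Fin n → ℝ) :
    MemLp f 2 (boxMeasure a b) := (compactlyCarried_boxMeasure a b).memLp hf 2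

lemma memLp_boundary {f : (Fin n → ℝ) → ℝ} (hf : Continuous f) (a b : Fin n → ℝ) :
    MemLp f 2 (boundaryMeasure a b) := (compactlyCarried_boundaryMeasure a b).memLp hf 2

lemma isOpen_box : IsOpen (box a b) := isOpen_set_pi Set.finite_univ fun _ _ => isOpen_Ioo

/-- The fundamental lemma of the calculus of variations. It identifies the gradient in a Rayleigh
quotient with the one carried by the sequence defining the trace. -/
lemma HasWeakGradient.unique {u : L2Box a b} {G G' : Fin n → L2Box a b}
    (h : HasWeakGradient a b u G) (h' : HasWeakGradient a b u G') : G = G' := by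
  ext1 j
  have hint : ∀ (v : L2Box a b) (φ : (Fin n → ℝ) → ℝ), IsTestFunction a b φ →
      Integrable (fun x => v x * φ x) (boxMeasure a b) := fun v φ hφ =>
    (Lp.memLp v).integrable_mul (memLp_box hφ.1.continuous a b)
  have hv : Integrable (fun x => G j x - G' j x) (boxMeasure a b) :=
    ((Lp.memLp (G j)).integrable one_le_two).sub ((Lp.memLp (G' j)).integrable one_le_two)
  have key := isOpen_box.ae_eq_zero_of_integral_contDiff_smul_eq_zero (U := box a b)
    hv.integrableOn.locallyIntegrableOn (fun φ h1 h2 h3 => by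
      have hφ : IsTestFunction a b φ := ⟨h1, h2, h3⟩
      have e1 := h j φ hφ
      have e2 := h' j φ hφ
      have : ∫ x, φ x • (G j x - G' j x) ∂boxMeasure a b =
          (∫ x, G j x * φ x ∂boxMeasure a b) - ∫ x, G' j x * φ x ∂boxMeasure a b := by
        rw [← integral_sub (hint _ _ hφ) (hint _ _ hφ)]
        congr 1; ext x
        rw [smul_eq_mul]; ring
      linarith)
  refine Lp.ext ?_
  filter_upwards [key, ae_restrict_mem isOpen_box.measurableSet] with x hx hx'
  exact sub_eq_zero.1 (hx hx')

/-- The energy inequality for `H¹` functions. -/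
lemma le_robinForm {α g : ℝ} (hg : 0 ≤ g) {lam : Fin n → ℝ} {χ : Fin n → ℝ → ℝ}
    (h : ∀ i, IsGroundState (a i) (b i) α (lam i) g (χ i))
    {u : L2Box a b} {G : Fin n → L2Box a b} {w : L2Boundary a b}
    (hG : HasWeakGradient a b u G) (hw : HasTrace a b u w) :
    ((∑ i, lam i) * ‖u‖ ^ 2) + g * (‖u‖ ^ 2 - (inner ℝ u ((memLp_box
      (continuous_prod_coord fun i => (h i).continuous) a b).toLp _)) ^ 2) ≤
        (∑ j, ‖G j‖ ^ 2) + α * ‖w‖ ^ 2 := by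
  obtain ⟨φ, hφ, ⟨G', hG', hu, hgrad⟩, htr⟩ := hw
  obtain rfl := hG.unique hG'
  have t1 := tendsto_toLp (fun m => memLp_box (hφ m).continuous a b) hu
  have t2 := fun j => tendsto_toLp
    (fun m => memLp_box (continuous_partialDeriv (hφ m) j) a b) (hgrad j)
  have t3 := tendsto_toLp (fun m => memLp_boundary (hφ m).continuous a b) htr
  set Φ := (memLp_box (continuous_prod_coord fun i => (h i).continuous) a b).toLp _ with hΦ
  -- One smooth sequence converges in value, gradient and boundary value, and every term of the
  -- inequality is continuous in these.
  refine le_of_tendsto_of_tendsto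
    (((t1.norm.pow 2).const_mul _).add (((t1.norm.pow 2).sub
      ((t1.inner (tendsto_const_nhds (x := Φ))).pow 2)).const_mul g))
    ((tendsto_finsetSum _ fun j _ => (t2 j).norm.pow 2).add ((t3.norm.pow 2).const_mul α))
    (Eventually.of_forall fun m => ?_)
  have := le_boxEnergy hg h (hφ m)
  simp only [hΦ, norm_toLp_sq, inner_toLp]
  exact this

/-- The upper bounds for the Rayleigh quotient on `k`-dimensional subspaces of `H¹`. -/
def robinBounds (a b : Fin n → ℝ) (α : ℝ) (k : ℕ) : Set ℝ :=
  {c : ℝ | ∃ U : Submodule ℝ (L2Box a b), Module.finrank ℝ U = k ∧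
    (∀ u ∈ U, MemH1 a b u) ∧ ∀ u ∈ U, u ≠ 0 → ∃ r, IsRobinQuotient a b α u r ∧ r ≤ c}

lemma norm_prod_groundState {α g : ℝ} {lam : Fin n → ℝ} {χ : Fin n → ℝ → ℝ}
    (h : ∀ i, IsGroundState (a i) (b i) α (lam i) g (χ i)) :
    ‖(memLp_box (continuous_prod_coord fun i => (h i).continuous) a b).toLp _‖ = 1 := by
  have : ‖(memLp_box (continuous_prod_coord fun i => (h i).continuous) a b).toLp _‖ ^ 2 = 1 := by
    rw [norm_toLp_sq, integral_prod_sq]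
    exact Finset.prod_eq_one fun i _ => (h i).norm
  exact (pow_eq_one_iff_of_nonneg (norm_nonneg _) two_ne_zero).1 this

lemma le_of_mem_robinBounds_one {α g : ℝ} (hg : 0 ≤ g) {lam : Fin n → ℝ} {χ : Fin n → ℝ → ℝ}
    (h : ∀ i, IsGroundState (a i) (b i) α (lam i) g (χ i)) {c : ℝ}
    (hc : c ∈ robinBounds a b α 1) : ∑ i, lam i ≤ c := by
  obtain ⟨U, hU, -, hq⟩ := hc
  have hne : U ≠ ⊥ := by
    rintro rfl
    simp at hU
  obtain ⟨u, hu, hu0⟩ := U.exists_mem_ne_zero_of_ne_bot hne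
  obtain ⟨r, ⟨G, w, hG, hw, rfl⟩, hr⟩ := hq u hu hu0
  refine le_trans ?_ hr
  have hpos : 0 < ‖u‖ ^ 2 := by positivity
  rw [le_div_iff₀ hpos]
  have key := le_robinForm hg h hG hw
  set Φ := (memLp_box (continuous_prod_coord fun i => (h i).continuous) a b).toLp _ with hΦ
  have h1 : ‖Φ‖ = 1 := norm_prod_groundState h
  have h2 := abs_real_inner_le_norm u Φ
  rw [h1, mul_one] at h2
  have h3 : inner ℝ u Φ ^ 2 ≤ ‖u‖ ^ 2 := sq_le_sq' (abs_le.1 h2).1 (abs_le.1 h2).2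
  have := mul_nonneg hg (sub_nonneg.2 h3)
  linarith

lemma le_of_mem_robinBounds_two {α g : ℝ} (hg : 0 ≤ g) {lam : Fin n → ℝ} {χ : Fin n → ℝ → ℝ}
    (h : ∀ i, IsGroundState (a i) (b i) α (lam i) g (χ i)) {c : ℝ}
    (hc : c ∈ robinBounds a b α 2) : ∑ i, lam i + g ≤ c := by
  obtain ⟨U, hU, -, hq⟩ := hc
  set Φ := (memLp_box (continuous_prod_coord fun i => (h i).continuous) a b).toLp _ with hΦ
  -- An infinite-dimensional space has `finrank` equal to `0`, so `finrank = 2` forces finite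
  -- dimension; the functional `⟨Φ, ·⟩` then has a nonzero kernel on the plane.
  have : FiniteDimensional ℝ U := Module.finite_of_finrank_pos (by omega)
  have hker := LinearMap.ker_ne_bot_of_finrank_lt
    (f := (innerSL ℝ Φ).toLinearMap.comp U.subtype) (by simp [hU])
  obtain ⟨⟨u, hu⟩, hk, hu0⟩ := Submodule.exists_mem_ne_zero_of_ne_bot hker
  have hu0' : u ≠ 0 := fun h => hu0 (by ext1; exact h)
  have hin : inner ℝ u Φ = 0 := by
    rw [real_inner_comm]
    simpa using hk
  obtain ⟨r, ⟨G, w, hG, hw, rfl⟩, hr⟩ := hq u hu hu0'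
  refine le_trans ?_ hr
  have hpos : 0 < ‖u‖ ^ 2 := by positivity
  rw [le_div_iff₀ hpos]
  have key := le_robinForm hg h hG hw
  rw [← hΦ, hin] at key
  linarith

end H1

/-! ### Product functions and upper bounds -/

section Product

variable {n : ℕ} {a b : Fin n → ℝ}

lemma prod_update_coord {X : Fin n → Type*} (f : ∀ i, X i → ℝ) (j : Fin n) (g : X j → ℝ)
    (x : ∀ i, X i) :
    ∏ i, Function.update f j g i (x i) = g (x j) * ∏ i ∈ Finset.univ.erase j, f i (x i) := by
  rw [← Finset.mul_prod_erase _ _ (Finset.mem_univ j), Function.update_self]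
  congr 1
  refine Finset.prod_congr rfl fun i hi => ?_
  rw [Function.update_of_ne (Finset.ne_of_mem_erase hi)]

lemma partialDeriv_prod {f : Fin n → ℝ → ℝ} (hf : ∀ i, ContDiff ℝ ∞ (f i)) (j : Fin n)
    (x : Fin n → ℝ) :
    partialDeriv j (fun x => ∏ i, f i (x i)) x =
      ∏ i, Function.update f j (deriv (f j)) i (x i) := by
  rw [partialDeriv_eq_deriv (contDiff_prod_coord hf), prod_update_coord]
  have : (fun s : ℝ => ∏ i, f i ((x + s • (Pi.single j 1 : Fin n → ℝ)) i)) =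
      fun s => f j (x j + s) * ∏ i ∈ Finset.univ.erase j, f i (x i) := by
    ext s
    rw [← Finset.mul_prod_erase _ _ (Finset.mem_univ j)]
    congr 1
    · simp
    · refine Finset.prod_congr rfl fun i hi => ?_
      simp [Finset.ne_of_mem_erase hi]
  rw [this, deriv_mul_const_field, deriv_comp_const_add (f j) (x j) 0, add_zero]

lemma integral_partialDeriv_prod_sq {f : Fin n → ℝ → ℝ} (hf : ∀ i, ContDiff ℝ ∞ (f i))
    (j : Fin n) :
    ∫ x, partialDeriv j (fun x => ∏ i, f i (x i)) x ^ 2 ∂boxMeasure a b =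
      (∫ t in Set.Ioo (a j) (b j), deriv (f j) t ^ 2) *
        ∏ i ∈ Finset.univ.erase j, ∫ t in Set.Ioo (a i) (b i), f i t ^ 2 := by
  simp_rw [partialDeriv_prod hf]
  rw [integral_prod_sq, ← Finset.mul_prod_erase _ _ (Finset.mem_univ j), Function.update_self]
  congr 1
  refine Finset.prod_congr rfl fun i hi => ?_
  rw [Function.update_of_ne (Finset.ne_of_mem_erase hi)]

lemma integral_face_prod_sq (f : Fin n → ℝ → ℝ) (j : Fin n) (c : ℝ) :
    ∫ x, (∏ i, f i (x i)) ^ 2 ∂faceMeasure a b j c =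
      f j c ^ 2 * ∏ i ∈ Finset.univ.erase j, ∫ t in Set.Ioo (a i) (b i), f i t ^ 2 := by
  simp_rw [← Finset.prod_pow]
  rw [faceMeasure, integral_fintype_prod_eq_prod (fun i t => f i t ^ 2),
    ← Finset.mul_prod_erase _ _ (Finset.mem_univ j)]
  congr 1
  · simp
  · refine Finset.prod_congr rfl fun i hi => ?_
    rw [if_neg (Finset.ne_of_mem_erase hi)]

/-- Each derivative or face in direction `j` touches only the `j`-th factor; the others contribute
their squared norms. -/
lemma boxEnergy_prod (α : ℝ) {f : Fin n → ℝ → ℝ} (hf : ∀ i, ContDiff ℝ ∞ (f i)) :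
    boxEnergy a b α (fun x => ∏ i, f i (x i)) = ∑ j, energy (a j) (b j) α (f j) *
      ∏ i ∈ Finset.univ.erase j, ∫ t in Set.Ioo (a i) (b i), f i t ^ 2 := by
  have hc : Continuous fun x : Fin n → ℝ => (∏ i, f i (x i)) ^ 2 :=
    (contDiff_prod_coord hf).continuous.pow 2
  unfold boxEnergy energy
  rw [integral_boundaryMeasure a b hc, Finset.mul_sum, ← Finset.sum_add_distrib]
  refine Finset.sum_congr rfl fun j _ => ?_
  rw [integral_partialDeriv_prod_sq hf, integral_face_prod_sq, integral_face_prod_sq]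
  ring

lemma boxEnergy_prod_le {α : ℝ} {m : Fin n → ℝ} {f : Fin n → ℝ → ℝ}
    (hf : ∀ i, ContDiff ℝ ∞ (f i))
    (h : ∀ i, energy (a i) (b i) α (f i) ≤ m i * ∫ t in Set.Ioo (a i) (b i), f i t ^ 2) :
    boxEnergy a b α (fun x => ∏ i, f i (x i)) ≤
      (∑ i, m i) * ∫ x, (∏ i, f i (x i)) ^ 2 ∂boxMeasure a b := by
  rw [boxEnergy_prod α hf, integral_prod_sq, Finset.sum_mul]
  refine Finset.sum_le_sum fun j _ => ?_
  rw [← Finset.mul_prod_erase _ _ (Finset.mem_univ j), ← mul_assoc]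
  exact mul_le_mul_of_nonneg_right (h j)
    (Finset.prod_nonneg fun i _ => integral_nonneg fun t => sq_nonneg _)

/-- Test functions vanish off the box, so the integrals extend to the whole space and integration by
parts has no boundary term. -/
lemma hasWeakGradient_toLp {f : (Fin n → ℝ) → ℝ} (hf : ContDiff ℝ ∞ f) :
    HasWeakGradient a b ((memLp_box hf.continuous a b).toLp f)
      (fun j => (memLp_box (continuous_partialDeriv hf j) a b).toLp _) := by
  intro j φ hφ
  have e1 : ∫ x, (memLp_box hf.continuous a b).toLp f x * partialDeriv j φ x ∂boxMeasure a b =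
      ∫ x in box a b, f x * partialDeriv j φ x := by
    refine integral_congr_ae ?_
    filter_upwards [(memLp_box hf.continuous a b).coeFn_toLp] with x hx
    rw [hx]
  have e2 : ∫ x, (memLp_box (continuous_partialDeriv hf j) a b).toLp _ x * φ x ∂boxMeasure a b =
      ∫ x in box a b, partialDeriv j f x * φ x := by
    refine integral_congr_ae ?_
    filter_upwards [(memLp_box (continuous_partialDeriv hf j) a b).coeFn_toLp] with x hx
    rw [hx]
  have hφc := hφ.1.continuous
  have hdφ := continuous_partialDeriv hφ.1 j
  have hdf := continuous_partialDeriv hf j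
  have hsupp : HasCompactSupport (partialDeriv j φ) := hφ.2.1.fderiv_apply (𝕜 := ℝ) _
  have z1 : ∀ x ∉ box a b, φ x = 0 := fun x hx =>
    image_eq_zero_of_notMem_tsupport fun h => hx (hφ.2.2 h)
  have z2 : ∀ x ∉ box a b, partialDeriv j φ x = 0 := fun x hx => by
    have : fderiv ℝ φ x = 0 :=
      image_eq_zero_of_notMem_tsupport fun h => hx (hφ.2.2 (tsupport_fderiv_subset ℝ h))
    simp [partialDeriv, this]
  rw [e1, e2, setIntegral_eq_integral_of_forall_compl_eq_zero (fun x hx => by rw [z2 x hx, mul_zero]),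
    setIntegral_eq_integral_of_forall_compl_eq_zero (fun x hx => by rw [z1 x hx, mul_zero])]
  exact integral_mul_fderiv_eq_neg_fderiv_mul_of_integrable
    ((hdf.mul hφc).integrable_of_hasCompactSupport hφ.2.1.mul_left)
    ((hf.continuous.mul hdφ).integrable_of_hasCompactSupport hsupp.mul_left)
    ((hf.continuous.mul hφc).integrable_of_hasCompactSupport hφ.2.1.mul_left)
    (fun x _ => hf.contDiffAt.differentiableAt (by simp))
    (fun x _ => hφ.1.contDiffAt.differentiableAt (by simp))

lemma eLpNorm_sub_toLp_self {X : Type*} [MeasurableSpace X] {μ : Measure X} {f : X → ℝ}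
    (hf : MemLp f 2 μ) (g : X → ℝ) :
    eLpNorm (fun x => g x - hf.toLp f x) 2 μ = eLpNorm (fun x => g x - f x) 2 μ := by
  refine eLpNorm_congr_ae ?_
  filter_upwards [hf.coeFn_toLp] with x hx
  rw [hx]

/-- A smooth function is its own approximating sequence, so its trace is its restriction. -/
lemma isRobinQuotient_toLp (α : ℝ) {f : (Fin n → ℝ) → ℝ} (hf : ContDiff ℝ ∞ f) :
    IsRobinQuotient a b α ((memLp_box hf.continuous a b).toLp f)
      (boxEnergy a b α f / ∫ x, f x ^ 2 ∂boxMeasure a b) := by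
  refine ⟨_, (memLp_boundary hf.continuous a b).toLp f, hasWeakGradient_toLp hf,
    ⟨fun _ => f, fun _ => hf, ⟨_, hasWeakGradient_toLp hf, ?_, fun j => ?_⟩, ?_⟩, ?_⟩
  · simp [eLpNorm_sub_toLp_self]
  · simp [eLpNorm_sub_toLp_self]
  · simp [eLpNorm_sub_toLp_self]
  · simp_rw [norm_toLp_sq]
    rfl

lemma isDirichletQuotient_toLp {f : (Fin n → ℝ) → ℝ} (hf : ContDiff ℝ ∞ f) :
    IsDirichletQuotient a b ((memLp_box hf.continuous a b).toLp f)
      (boxEnergy a b 0 f / ∫ x, f x ^ 2 ∂boxMeasure a b) := by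
  refine ⟨_, hasWeakGradient_toLp hf, ?_⟩
  simp_rw [norm_toLp_sq]
  rw [boxEnergy, zero_mul, add_zero]

/-- The linear map sending `v` to the class of
`x ↦ (∑ l, v l χ l (x j)) ∏_{i ≠ j} φ i (x i)`. -/
noncomputable def prodMap (a b : Fin n → ℝ) {k : ℕ} (j : Fin n) {χ : Fin k → ℝ → ℝ}
    {φ : Fin n → ℝ → ℝ}
    (h : ∀ (v : Fin k → ℝ) i, ContDiff ℝ ∞ (Function.update φ j (fun t => ∑ l, v l * χ l t) i)) :
    (Fin k → ℝ) →ₗ[ℝ] L2Box a b where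
  toFun v := (memLp_box (contDiff_prod_coord (h v)).continuous a b).toLp _
  map_add' v w := by
    rw [← MemLp.toLp_add]
    refine (MemLp.toLp_eq_toLp_iff _ _).2 (Eventually.of_forall fun x => ?_)
    simp only [Pi.add_apply, prod_update_coord, add_mul, Finset.sum_add_distrib]
  map_smul' c v := by
    rw [RingHom.id_apply, ← MemLp.toLp_const_smul]
    refine (MemLp.toLp_eq_toLp_iff _ _).2 (Eventually.of_forall fun x => ?_)
    simp only [Pi.smul_apply, prod_update_coord, smul_eq_mul, mul_assoc, ← Finset.mul_sum]

lemma finrank_range_prodMap {k : ℕ} (j : Fin n) {χ : Fin k → ℝ → ℝ} {φ : Fin n → ℝ → ℝ}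
    (h : ∀ (v : Fin k → ℝ) i, ContDiff ℝ ∞ (Function.update φ j (fun t => ∑ l, v l * χ l t) i))
    (hpos : ∀ v : Fin k → ℝ, v ≠ 0 → ∀ i,
      0 < ∫ t in Set.Ioo (a i) (b i), Function.update φ j (fun t => ∑ l, v l * χ l t) i t ^ 2) :
    Module.finrank ℝ (LinearMap.range (prodMap a b j h)) = k := by
  rw [LinearMap.finrank_range_of_inj, Module.finrank_fin_fun]
  rw [injective_iff_map_eq_zero]
  intro v hv
  by_contra hne
  have h1 : ‖prodMap a b j h v‖ ^ 2 = _ :=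
    norm_toLp_sq (memLp_box (contDiff_prod_coord (h v)).continuous a b)
  rw [integral_prod_sq, hv, norm_zero] at h1
  have := Finset.prod_pos fun i (_ : i ∈ Finset.univ) => hpos v hne i
  rw [← h1] at this
  norm_num at this

lemma memH1_toLp {f : (Fin n → ℝ) → ℝ} (hf : ContDiff ℝ ∞ f) :
    MemH1 a b ((memLp_box hf.continuous a b).toLp f) := ⟨_, hasWeakGradient_toLp hf⟩

/-- Only the `j`-th factor varies, so the trial space is linear although each element is a pure
product, and one-dimensional bounds add up. -/
lemma sum_mem_robinBounds {k : ℕ} {α : ℝ} (j : Fin n) {χ : Fin k → ℝ → ℝ} {φ : Fin n → ℝ → ℝ}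
    {m : Fin n → ℝ}
    (h : ∀ (v : Fin k → ℝ) i, ContDiff ℝ ∞ (Function.update φ j (fun t => ∑ l, v l * χ l t) i))
    (hpos : ∀ v : Fin k → ℝ, v ≠ 0 → ∀ i,
      0 < ∫ t in Set.Ioo (a i) (b i), Function.update φ j (fun t => ∑ l, v l * χ l t) i t ^ 2)
    (hm : ∀ (v : Fin k → ℝ) i,
      energy (a i) (b i) α (Function.update φ j (fun t => ∑ l, v l * χ l t) i) ≤
        m i * ∫ t in Set.Ioo (a i) (b i),
          Function.update φ j (fun t => ∑ l, v l * χ l t) i t ^ 2) :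
    ∑ i, m i ∈ robinBounds a b α k := by
  refine ⟨LinearMap.range (prodMap a b j h), finrank_range_prodMap j h hpos, ?_, ?_⟩
  · rintro _ ⟨v, rfl⟩
    exact memH1_toLp (contDiff_prod_coord (h v))
  · rintro _ ⟨v, rfl⟩ hne
    have hv : v ≠ 0 := by
      rintro rfl
      exact hne (map_zero _)
    refine ⟨_, isRobinQuotient_toLp α (contDiff_prod_coord (h v)), ?_⟩
    rw [div_le_iff₀]
    · exact boxEnergy_prod_le (h v) (hm v)
    · rw [integral_prod_sq]
      exact Finset.prod_pos fun i _ => hpos v hv i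

/-- The upper bounds for the Rayleigh quotient on `k`-dimensional subspaces of `H¹₀`. -/
def dirichletBounds (a b : Fin n → ℝ) (k : ℕ) : Set ℝ :=
  {c : ℝ | ∃ U : Submodule ℝ (L2Box a b), Module.finrank ℝ U = k ∧
    (∀ u ∈ U, MemH10 a b u) ∧ ∀ u ∈ U, u ≠ 0 → ∃ r, IsDirichletQuotient a b u r ∧ r ≤ c}

end Product

/-! ### Approximation by test functions -/

lemma exists_bound_deriv_smoothTransition :
    ∃ C : ℝ, 0 ≤ C ∧ ∀ x, |deriv Real.smoothTransition x| ≤ C := by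
  have hs : ContDiff ℝ ∞ Real.smoothTransition := Real.smoothTransition.contDiff
  obtain ⟨C, hC⟩ := (isCompact_Icc (a := (0 : ℝ)) (b := 1)).exists_bound_of_continuousOn
    (smooth_deriv hs).continuous.continuousOn
  have hC0 : 0 ≤ C := (norm_nonneg _).trans (hC 0 ⟨le_rfl, zero_le_one⟩)
  refine ⟨C, hC0, fun x => ?_⟩
  rcases lt_or_ge x 0 with h | h
  · have : Real.smoothTransition =ᶠ[𝓝 x] fun _ => 0 := by
      filter_upwards [gt_mem_nhds h] with y hy using Real.smoothTransition.zero_of_nonpos hy.le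
    rw [this.deriv_eq]
    simpa using hC0
  rcases lt_or_ge 1 x with h' | h'
  · have : Real.smoothTransition =ᶠ[𝓝 x] fun _ => 1 := by
      filter_upwards [lt_mem_nhds h'] with y hy using Real.smoothTransition.one_of_one_le hy.le
    rw [this.deriv_eq]
    simpa using hC0
  · exact hC x ⟨h, h'⟩

lemma deriv_smoothTransition_of_one_lt {x : ℝ} (h : 1 < x) :
    deriv Real.smoothTransition x = 0 := by
  have : Real.smoothTransition =ᶠ[𝓝 x] fun _ => 1 := by
    filter_upwards [lt_mem_nhds h] with y hy using Real.smoothTransition.one_of_one_le hy.le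
  rw [this.deriv_eq]
  simp

/-- A smooth function on `[a, b]` vanishing at the endpoints is approximated, with first
derivatives, by functions supported inside `(a, b)`. -/
lemma exists_cutoff {a b : ℝ} {f : ℝ → ℝ} (hab : a < b) (hf : ContDiff ℝ ∞ f) (ha : f a = 0)
    (hb : f b = 0) :
    ∃ (F : ℕ → ℝ → ℝ) (C : ℝ), (∀ m, ContDiff ℝ ∞ (F m)) ∧
      (∀ m, ∃ c d, a < c ∧ d < b ∧ ∀ x ∉ Set.Icc c d, F m x = 0) ∧
      (∀ m, ∀ x ∈ Set.Ioo a b, |F m x| ≤ C ∧ |deriv (F m) x| ≤ C) ∧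
      ∀ x ∈ Set.Ioo a b, ∀ᶠ m in atTop, F m x = f x ∧ deriv (F m) x = deriv f x := by
  obtain ⟨C, hC0, hC⟩ := exists_bound_deriv_smoothTransition
  obtain ⟨M, hM⟩ := (isCompact_Icc (a := a) (b := b)).exists_bound_of_continuousOn
    hf.continuous.continuousOn
  obtain ⟨L, hL⟩ := (isCompact_Icc (a := a) (b := b)).exists_bound_of_continuousOn
    (smooth_deriv hf).continuous.continuousOn
  have hL0 : 0 ≤ L := (norm_nonneg _).trans (hL a ⟨le_rfl, hab.le⟩)
  have hM0 : 0 ≤ M := (norm_nonneg _).trans (hM a ⟨le_rfl, hab.le⟩)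
  have lip : ∀ x ∈ Set.Icc a b, ∀ y ∈ Set.Icc a b, |f y - f x| ≤ L * |y - x| :=
    fun x hx y hy => (convex_Icc a b).norm_image_sub_le_of_norm_deriv_le
      (fun z _ => (hf.differentiable (by simp)).differentiableAt) hL hx hy
  set s := Real.smoothTransition with hs
  have hsm : ContDiff ℝ ∞ s := Real.smoothTransition.contDiff
  have hs1 : ∀ x, |s x| ≤ 1 := fun x =>
    abs_le.2 ⟨by linarith [Real.smoothTransition.nonneg x], Real.smoothTransition.le_one x⟩
  -- The cutoff vanishes within `1 / (m + 1)` of an endpoint and its factor at that endpoint is `1`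
  -- beyond `2 / (m + 1)`.
  set F : ℕ → ℝ → ℝ := fun m x =>
    s ((m + 1) * (x - a) - 1) * s ((m + 1) * (b - x) - 1) * f x with hF
  have hd : ∀ m x, deriv (F m) x =
      deriv s ((m + 1) * (x - a) - 1) * (m + 1) * f x * s ((m + 1) * (b - x) - 1) -
      s ((m + 1) * (x - a) - 1) * (deriv s ((m + 1) * (b - x) - 1) * (m + 1) * f x) +
      s ((m + 1) * (x - a) - 1) * s ((m + 1) * (b - x) - 1) * deriv f x := by
    intro m x
    have d1 : HasDerivAt (fun x => s (((m : ℝ) + 1) * (x - a) - 1))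
        (deriv s ((m + 1) * (x - a) - 1) * ((m + 1) * 1)) x :=
      (smooth_hasDerivAt hsm _).comp x
        ((((hasDerivAt_id x).sub_const a).const_mul ((m : ℝ) + 1)).sub_const 1)
    have d2 : HasDerivAt (fun x => s (((m : ℝ) + 1) * (b - x) - 1))
        (deriv s ((m + 1) * (b - x) - 1) * ((m + 1) * -1)) x :=
      (smooth_hasDerivAt hsm _).comp x
        ((((hasDerivAt_id x).const_sub b).const_mul ((m : ℝ) + 1)).sub_const 1)
    have := ((d1.mul d2).mul (smooth_hasDerivAt hf x)).deriv
    refine Eq.trans this ?_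
    simp only [Pi.mul_apply]
    ring
  -- The factor `m + 1` from differentiating the cutoff matters only where `(m + 1) y ≤ 2`; there
  -- `|f| ≤ L y` compensates it, uniformly in `m`.
  have bound : ∀ (m : ℕ) (y z : ℝ), 0 ≤ y → |z| ≤ L * y →
      |deriv s ((m + 1) * y - 1) * (m + 1) * z| ≤ C * (2 * L) := by
    intro m y z hy hz
    have hm : (0 : ℝ) < m + 1 := by positivity
    rcases lt_or_ge 1 (((m : ℝ) + 1) * y - 1) with h | h
    · rw [deriv_smoothTransition_of_one_lt h]
      simp only [zero_mul, abs_zero]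
      positivity
    · rw [mul_assoc, abs_mul]
      refine mul_le_mul (hC _) ?_ (abs_nonneg _) hC0
      rw [abs_mul, abs_of_pos hm]
      calc (m + 1) * |z| ≤ (m + 1) * (L * y) := mul_le_mul_of_nonneg_left hz hm.le
        _ = L * ((m + 1) * y) := by ring
        _ ≤ L * 2 := mul_le_mul_of_nonneg_left (by linarith) hL0
        _ = 2 * L := by ring
  refine ⟨F, M + (C * (2 * L) + C * (2 * L) + L), fun m => ?_, fun m => ?_,
    fun m x hx => ⟨?_, ?_⟩, fun x hx => ?_⟩
  · exact ((hsm.comp (by fun_prop)).mul (hsm.comp (by fun_prop))).mul hf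
  · have hm : (0 : ℝ) < m + 1 := by positivity
    refine ⟨a + 1 / (m + 1), b - 1 / (m + 1), by simpa using hm, by simpa using hm,
      fun x hx => ?_⟩
    by_contra hne
    have h1 : 0 < (m + 1) * (x - a) - 1 := by
      by_contra hcon
      exact hne (by simp [hF, hs, Real.smoothTransition.zero_of_nonpos (not_lt.1 hcon)])
    have h2 : 0 < (m + 1) * (b - x) - 1 := by
      by_contra hcon
      exact hne (by simp [hF, hs, Real.smoothTransition.zero_of_nonpos (not_lt.1 hcon)])
    refine hx ⟨?_, ?_⟩
    · have : 1 / ((m : ℝ) + 1) ≤ x - a := by rw [div_le_iff₀ hm]; linarith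
      linarith
    · have : 1 / ((m : ℝ) + 1) ≤ b - x := by rw [div_le_iff₀ hm]; linarith
      linarith
  · have h1 : |F m x| ≤ 1 * 1 * M := by
      simp only [hF, abs_mul]
      exact mul_le_mul (mul_le_mul (hs1 _) (hs1 _) (abs_nonneg _) zero_le_one)
        (hM x ⟨hx.1.le, hx.2.le⟩) (abs_nonneg _) (by norm_num)
    have : 0 ≤ C * (2 * L) := by positivity
    linarith
  · rw [hd]
    have hxI : x ∈ Set.Icc a b := ⟨hx.1.le, hx.2.le⟩
    have b1 := bound m (x - a) (f x) (by linarith [hx.1]) (by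
      have := lip a ⟨le_rfl, hab.le⟩ x hxI
      rwa [ha, sub_zero, abs_of_pos (sub_pos.2 hx.1)] at this)
    have b2 := bound m (b - x) (f x) (by linarith [hx.2]) (by
      have := lip b ⟨hab.le, le_rfl⟩ x hxI
      rwa [hb, sub_zero, abs_sub_comm, abs_of_pos (sub_pos.2 hx.2)] at this)
    have hCL : 0 ≤ C * (2 * L) := by positivity
    have k1 := mul_le_mul b1 (hs1 ((m + 1) * (b - x) - 1)) (abs_nonneg _) hCL
    have k2 := mul_le_mul (hs1 ((m + 1) * (x - a) - 1)) b2 (abs_nonneg _) zero_le_one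
    have k3 := mul_le_mul (mul_le_mul (hs1 ((m + 1) * (x - a) - 1))
      (hs1 ((m + 1) * (b - x) - 1)) (abs_nonneg _) zero_le_one) (hL x hxI) (abs_nonneg _)
      (by norm_num)
    rw [Real.norm_eq_abs] at k3
    rw [← abs_mul] at k1 k2 k3
    rw [← abs_mul] at k3
    refine (abs_add_le _ _).trans ?_
    have := abs_sub (deriv s ((m + 1) * (x - a) - 1) * (m + 1) * f x * s ((m + 1) * (b - x) - 1))
      (s ((m + 1) * (x - a) - 1) * (deriv s ((m + 1) * (b - x) - 1) * (m + 1) * f x))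
    linarith
  · have l1 : Tendsto (fun m : ℕ => ((m : ℝ) + 1) * (x - a)) atTop atTop :=
      (tendsto_natCast_atTop_atTop.atTop_add tendsto_const_nhds).atTop_mul_const
        (sub_pos.2 hx.1)
    have l2 : Tendsto (fun m : ℕ => ((m : ℝ) + 1) * (b - x)) atTop atTop :=
      (tendsto_natCast_atTop_atTop.atTop_add tendsto_const_nhds).atTop_mul_const
        (sub_pos.2 hx.2)
    filter_upwards [l1.eventually_gt_atTop 2, l2.eventually_gt_atTop 2] with m h1 h2
    have e1 : s ((m + 1) * (x - a) - 1) = 1 :=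
      Real.smoothTransition.one_of_one_le (by linarith)
    have e2 : s ((m + 1) * (b - x) - 1) = 1 :=
      Real.smoothTransition.one_of_one_le (by linarith)
    have e3 : deriv s ((m + 1) * (x - a) - 1) = 0 :=
      deriv_smoothTransition_of_one_lt (by linarith)
    have e4 : deriv s ((m + 1) * (b - x) - 1) = 0 :=
      deriv_smoothTransition_of_one_lt (by linarith)
    rw [hd]
    simp [hF, e1, e2, e3, e4]

/-! ### The Dirichlet problem -/

section Dirichlet

variable {n : ℕ} {a b : Fin n → ℝ}

/-- Dominated convergence on a finite measure: each point is eventually outside the cutoff region.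
-/
lemma tendsto_eLpNorm_of_eventually_eq {f : ℕ → (Fin n → ℝ) → ℝ} {g : (Fin n → ℝ) → ℝ}
    (hf : ∀ m, Continuous (f m)) (hg : Continuous g) {C : ℝ}
    (hC : ∀ m, ∀ x ∈ box a b, |f m x| ≤ C)
    (h : ∀ x ∈ box a b, ∀ᶠ m in atTop, f m x = g x) :
    Tendsto (fun m => eLpNorm (fun x => f m x - g x) 2 (boxMeasure a b)) atTop (𝓝 0) := by
  have hL := fun m => memLp_box ((hf m).sub hg) a b
  have hae : ∀ᵐ x ∂boxMeasure a b, x ∈ box a b := ae_restrict_mem isOpen_box.measurableSet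
  have hint : Tendsto (fun m => ∫ x, (f m x - g x) ^ 2 ∂boxMeasure a b) atTop (𝓝 0) := by
    have := tendsto_integral_of_dominated_convergence (μ := boxMeasure a b)
      (F := fun m x => (f m x - g x) ^ 2) (f := fun _ => (0 : ℝ)) (fun x => (C + |g x|) ^ 2)
      (fun m => (((hf m).sub hg).pow 2).aestronglyMeasurable)
      ((compactlyCarried_boxMeasure a b).integrable (by fun_prop))
      (fun m => by
        filter_upwards [hae] with x hx
        rw [Real.norm_eq_abs, abs_pow]
        exact pow_le_pow_left₀ (abs_nonneg _)
          ((abs_sub _ _).trans (add_le_add (hC m x hx) le_rfl)) 2)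
      (by
        filter_upwards [hae] with x hx
        refine tendsto_const_nhds.congr' ?_
        filter_upwards [h x hx] with m hm
        rw [hm, sub_self]
        norm_num)
    simpa using this
  have hnorm : Tendsto (fun m => ‖(hL m).toLp _‖) atTop (𝓝 0) := by
    have : ∀ m, ‖(hL m).toLp _‖ = √(∫ x, (f m x - g x) ^ 2 ∂boxMeasure a b) := fun m => by
      have := norm_toLp_sq (hL m)
      simp only [Pi.sub_apply] at this
      rw [← this, Real.sqrt_sq (norm_nonneg _)]
    simp_rw [this]
    simpa using hint.sqrt
  have := ENNReal.tendsto_ofReal hnorm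
  rw [ENNReal.ofReal_zero] at this
  refine this.congr fun m => ?_
  rw [Lp.norm_toLp, ENNReal.ofReal_toReal (hL m).2.ne]
  rfl

/-- Cutting off each factor gives test functions. Each `C i` bounds a factor and its derivative, so
`∏ C i` dominates the product and all its first partial derivatives. -/
lemma memH10_toLp_prod (hab : ∀ i, a i < b i) {f : Fin n → ℝ → ℝ}
    (hf : ∀ i, ContDiff ℝ ∞ (f i)) (ha : ∀ i, f i (a i) = 0) (hb : ∀ i, f i (b i) = 0) :
    MemH10 a b ((memLp_box (contDiff_prod_coord hf).continuous a b).toLp _) := by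
  choose F C hF hsupp hC hev using fun i => exists_cutoff (hab i) (hf i) (ha i) (hb i)
  choose c d hc hd hz using hsupp
  have hsm : ∀ m, ContDiff ℝ ∞ fun x : Fin n → ℝ => ∏ i, F i m (x i) := fun m =>
    contDiff_prod_coord fun i => hF i m
  have hsub : ∀ m, tsupport (fun x : Fin n → ℝ => ∏ i, F i m (x i)) ⊆
      Set.univ.pi fun i => Set.Icc (c i m) (d i m) := by
    intro m
    refine closure_minimal (fun x hx i _ => ?_) (isClosed_set_pi fun i _ => isClosed_Icc)
    by_contra hcon
    exact hx (Finset.prod_eq_zero (Finset.mem_univ i) (hz i m _ hcon))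
  refine ⟨fun m x => ∏ i, F i m (x i), fun m => ⟨hsm m, ?_, ?_⟩, _,
    hasWeakGradient_toLp (contDiff_prod_coord hf), ?_, fun j => ?_⟩
  · exact (isCompact_univ_pi fun i => isCompact_Icc).of_isClosed_subset
      (isClosed_tsupport _) (hsub m)
  · exact (hsub m).trans (Set.pi_mono fun i _ x hx =>
      ⟨(hc i m).trans_le hx.1, hx.2.trans_lt (hd i m)⟩)
  · simp_rw [eLpNorm_sub_toLp_self]
    refine tendsto_eLpNorm_of_eventually_eq (C := ∏ i, C i) (fun m => (hsm m).continuous)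
      (contDiff_prod_coord hf).continuous (fun m x hx => ?_) fun x hx => ?_
    · rw [Finset.abs_prod]
      exact Finset.prod_le_prod (fun i _ => abs_nonneg _)
        fun i _ => (hC i m (x i) (hx i trivial)).1
    · filter_upwards [eventually_all.2 fun i => hev i (x i) (hx i trivial)] with m hm
      exact Finset.prod_congr rfl fun i _ => (hm i).1
  · simp_rw [eLpNorm_sub_toLp_self]
    refine tendsto_eLpNorm_of_eventually_eq (C := ∏ i, C i)
      (fun m => continuous_partialDeriv (hsm m) j)
      (continuous_partialDeriv (contDiff_prod_coord hf) j) (fun m x hx => ?_) fun x hx => ?_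
    · rw [partialDeriv_prod (fun i => hF i m), Finset.abs_prod]
      refine Finset.prod_le_prod (fun i _ => abs_nonneg _) fun i _ => ?_
      rcases eq_or_ne i j with rfl | hij
      · rw [Function.update_self]
        exact (hC i m (x i) (hx i trivial)).2
      · rw [Function.update_of_ne hij]
        exact (hC i m (x i) (hx i trivial)).1
    · filter_upwards [eventually_all.2 fun i => hev i (x i) (hx i trivial)] with m hm
      rw [partialDeriv_prod (fun i => hF i m), partialDeriv_prod hf]
      refine Finset.prod_congr rfl fun i _ => ?_
      rcases eq_or_ne i j with rfl | hij
      · rw [Function.update_self, Function.update_self]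
        exact (hm i).2
      · rw [Function.update_of_ne hij, Function.update_of_ne hij]
        exact (hm i).1

lemma sum_mem_dirichletBounds (hab : ∀ i, a i < b i) {k : ℕ} (j : Fin n) {χ : Fin k → ℝ → ℝ}
    {φ : Fin n → ℝ → ℝ} {m : Fin n → ℝ}
    (h : ∀ (v : Fin k → ℝ) i, ContDiff ℝ ∞ (Function.update φ j (fun t => ∑ l, v l * χ l t) i))
    (hpos : ∀ v : Fin k → ℝ, v ≠ 0 → ∀ i,
      0 < ∫ t in Set.Ioo (a i) (b i), Function.update φ j (fun t => ∑ l, v l * χ l t) i t ^ 2)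
    (hm : ∀ (v : Fin k → ℝ) i,
      energy (a i) (b i) 0 (Function.update φ j (fun t => ∑ l, v l * χ l t) i) ≤
        m i * ∫ t in Set.Ioo (a i) (b i),
          Function.update φ j (fun t => ∑ l, v l * χ l t) i t ^ 2)
    (ha : ∀ (v : Fin k → ℝ) i, Function.update φ j (fun t => ∑ l, v l * χ l t) i (a i) = 0)
    (hb : ∀ (v : Fin k → ℝ) i, Function.update φ j (fun t => ∑ l, v l * χ l t) i (b i) = 0) :
    ∑ i, m i ∈ dirichletBounds a b k := by
  refine ⟨LinearMap.range (prodMap a b j h), finrank_range_prodMap j h hpos, ?_, ?_⟩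
  · rintro _ ⟨v, rfl⟩
    exact memH10_toLp_prod hab (h v) (ha v) (hb v)
  · rintro _ ⟨v, rfl⟩ hne
    have hv : v ≠ 0 := by
      rintro rfl
      exact hne (map_zero _)
    refine ⟨_, isDirichletQuotient_toLp (contDiff_prod_coord (h v)), ?_⟩
    rw [div_le_iff₀]
    · exact boxEnergy_prod_le (h v) (hm v)
    · rw [integral_prod_sq]
      exact Finset.prod_pos fun i _ => hpos v hv i

/-- A face measure lives where one coordinate equals an endpoint, which is outside the open box. -/
lemma eq_zero_of_isTestFunction {φ : (Fin n → ℝ) → ℝ} (h : IsTestFunction a b φ) :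
    ∀ᵐ x ∂boundaryMeasure a b, φ x = 0 := by
  have hc : Continuous fun x => φ x ^ 2 := h.1.continuous.pow 2
  have hface : ∀ j c, c = a j ∨ c = b j → ∀ᵐ x ∂faceMeasure a b j c, φ x = 0 := by
    intro j c hcj
    have hx : ∀ᵐ x ∂faceMeasure a b j c, x j = c := by
      have hq := Measure.tendsto_eval_ae_ae (μ := fun i => if i = j then Measure.dirac c else
        (volume : Measure ℝ).restrict (Set.Ioo (a i) (b i))) (i := j)
      refine hq.eventually (p := fun y => y = c) ?_
      simp only [if_true]
      exact (ae_dirac_iff (measurableSet_singleton c)).2 rfl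
    filter_upwards [hx] with x hx
    refine image_eq_zero_of_notMem_tsupport fun hmem => ?_
    have := h.2.2 hmem j trivial
    rw [hx] at this
    rcases hcj with rfl | rfl
    · exact lt_irrefl _ this.1
    · exact lt_irrefl _ this.2
  unfold boundaryMeasure
  rw [ae_finsetSum_measure_iff]
  intro j _
  rw [ae_add_measure_iff]
  exact ⟨hface j _ (Or.inl rfl), hface j _ (Or.inr rfl)⟩

lemma MemH10.hasTrace_zero {u : L2Box a b} (h : MemH10 a b u) : HasTrace a b u 0 := by
  obtain ⟨φ, hφ, hT⟩ := h
  refine ⟨φ, fun m => (hφ m).1, hT, ?_⟩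
  have : ∀ m, eLpNorm (fun x => φ m x - (0 : L2Boundary a b) x) 2 (boundaryMeasure a b) = 0 := by
    intro m
    rw [← eLpNorm_zero (p := 2) (μ := boundaryMeasure a b) (ε := ℝ)]
    refine eLpNorm_congr_ae ?_
    filter_upwards [eq_zero_of_isTestFunction (hφ m), Lp.coeFn_zero ℝ 2 (boundaryMeasure a b)]
      with x hx hx'
    rw [hx, hx']
    simp
  simp_rw [this]
  exact tendsto_const_nhds

/-- With trace zero the boundary term disappears whatever `α` is, so the two quotients agree. -/
lemma dirichletBounds_subset_robinBounds (α : ℝ) (k : ℕ) :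
    dirichletBounds a b k ⊆ robinBounds a b α k := by
  rintro c ⟨U, hU, hmem, hq⟩
  refine ⟨U, hU, fun u hu => ?_, fun u hu hne => ?_⟩
  · obtain ⟨φ, -, G, hG, -⟩ := hmem u hu
    exact ⟨G, hG⟩
  · obtain ⟨r, ⟨G, hG, hr⟩, hrc⟩ := hq u hu hne
    exact ⟨r, ⟨G, 0, hG, (hmem u hu).hasTrace_zero, by simp [hr]⟩, hrc⟩

end Dirichlet

/-! ### Pairs of eigenfunctions and the eigenvalues of the box -/

/-- An even and an odd solution on `(-ℓ, ℓ)` satisfying Robin or Dirichlet conditions. -/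
structure IsPair (ℓ α lam mu : ℝ) (φ ψ : ℝ → ℝ) : Prop where
  evenSol : IsSolution lam φ
  oddSol : IsSolution mu ψ
  even : ∀ x, φ (-x) = φ x
  odd : ∀ x, ψ (-x) = -ψ x
  deriv_zero : deriv φ 0 = 0
  bc_even : φ ℓ * deriv φ ℓ = -α * φ ℓ ^ 2
  bc_odd : ψ ℓ * deriv ψ ℓ = -α * ψ ℓ ^ 2
  le : lam ≤ mu
  even_pos : 0 < ∫ x in (0 : ℝ)..ℓ, φ x ^ 2
  odd_pos : 0 < ∫ x in (0 : ℝ)..ℓ, ψ x ^ 2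

lemma IsEvenState.isPair {ℓ α lam mu : ℝ} {φ ψ : ℝ → ℝ} (hℓ : 0 < ℓ)
    (h : IsEvenState ℓ α lam φ) (k : IsOddState ℓ α mu ψ) : IsPair ℓ α lam mu φ ψ where
  evenSol := h.toIsSolution
  oddSol := k.toIsSolution
  even := h.even
  odd := k.odd
  deriv_zero := h.deriv_zero
  bc_even := by rw [h.bc]; ring
  bc_odd := by rw [k.bc]; ring
  le := (h.lt_of_isOddState hℓ k).le
  even_pos := by
    simp_rw [sq]
    exact integral_mul_pos hℓ h.smooth.continuous h.smooth.continuous h.pos' h.pos'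
  odd_pos := by
    simp_rw [sq]
    exact integral_mul_pos hℓ k.smooth.continuous k.smooth.continuous k.pos k.pos

lemma isPair_dirichlet {ℓ : ℝ} (hℓ : 0 < ℓ) :
    IsPair ℓ 0 ((Real.pi / (2 * ℓ)) ^ 2) ((Real.pi / ℓ) ^ 2)
      (fun x => Real.cos (Real.pi / (2 * ℓ) * x)) (fun x => Real.sin (Real.pi / ℓ * x)) where
  evenSol := isSolution_cos _
  oddSol := isSolution_sin _
  even x := by simp
  odd x := by simp
  deriv_zero := by simp [deriv_cos_mul]
  bc_even := by
    have : Real.pi / (2 * ℓ) * ℓ = Real.pi / 2 := by field_simp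
    simp [this]
  bc_odd := by
    have : Real.pi / ℓ * ℓ = Real.pi := by field_simp
    simp [this]
  le := by
    have := Real.pi_pos
    gcongr
    linarith
  even_pos := by
    refine intervalIntegral.intervalIntegral_pos_of_pos_on
      (Continuous.intervalIntegrable (by fun_prop) _ _) (fun x hx => ?_) hℓ
    have h1 : Real.pi / (2 * ℓ) * x < Real.pi / 2 := by
      have : Real.pi / (2 * ℓ) * x < Real.pi / (2 * ℓ) * ℓ := by
        have := Real.pi_pos
        exact mul_lt_mul_of_pos_left hx.2 (by positivity)
      have e : Real.pi / (2 * ℓ) * ℓ = Real.pi / 2 := by field_simp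
      linarith
    have h2 : 0 < Real.pi / (2 * ℓ) * x := by
      have := Real.pi_pos
      have := hx.1
      positivity
    exact pow_pos (Real.cos_pos_of_mem_Ioo ⟨by linarith [Real.pi_pos], h1⟩) 2
  odd_pos := by
    refine intervalIntegral.intervalIntegral_pos_of_pos_on
      (Continuous.intervalIntegrable (by fun_prop) _ _) (fun x hx => ?_) hℓ
    have h1 : Real.pi / ℓ * x < Real.pi := by
      have : Real.pi / ℓ * x < Real.pi / ℓ * ℓ := by
        have := Real.pi_pos
        exact mul_lt_mul_of_pos_left hx.2 (by positivity)
      have e : Real.pi / ℓ * ℓ = Real.pi := by field_simp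
      linarith
    have h2 : 0 < Real.pi / ℓ * x := by
      have := Real.pi_pos
      have := hx.1
      positivity
    exact pow_pos (Real.sin_pos_of_pos_of_lt_pi h2 h1) 2

/-- The combination `s φ + t ψ`, moved to the interval `(a, b)`. -/
noncomputable def pairFun (a b : ℝ) (φ ψ : ℝ → ℝ) (s t x : ℝ) : ℝ :=
  s * φ (x - (a + b) / 2) + t * ψ (x - (a + b) / 2)

/-! ### Trial functions on one interval. -/

section PairFun

variable {a b α lam mu : ℝ} {φ ψ : ℝ → ℝ}

lemma IsPair.contDiff_pairFun (h : IsPair ((b - a) / 2) α lam mu φ ψ) (s t : ℝ) :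
    ContDiff ℝ ∞ (pairFun a b φ ψ s t) :=
  (contDiff_const.mul (contDiff_comp_sub h.evenSol.smooth _)).add
    (contDiff_const.mul (contDiff_comp_sub h.oddSol.smooth _))

lemma IsPair.pairFun_add (s t x : ℝ) :
    pairFun a b φ ψ s t ((a + b) / 2 + x) = s * φ x + t * ψ x := by
  unfold pairFun
  rw [add_sub_cancel_left]

lemma IsPair.pairFun_sub (h : IsPair ((b - a) / 2) α lam mu φ ψ) (s t x : ℝ) :
    pairFun a b φ ψ s t ((a + b) / 2 - x) = s * φ x - t * ψ x := by
  unfold pairFun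
  rw [show (a + b) / 2 - x - (a + b) / 2 = -x by ring, h.even, h.odd]
  ring

lemma IsPair.integral_pairFun_sq (hab : a < b) (h : IsPair ((b - a) / 2) α lam mu φ ψ)
    (s t : ℝ) :
    ∫ x in Set.Ioo a b, pairFun a b φ ψ s t x ^ 2 =
      2 * (s ^ 2 * (∫ x in (0 : ℝ)..(b - a) / 2, φ x ^ 2) +
        t ^ 2 * ∫ x in (0 : ℝ)..(b - a) / 2, ψ x ^ 2) := by
  have hc := (h.contDiff_pairFun s t).continuous
  have hφ := h.evenSol.smooth.continuous
  have hψ := h.oddSol.smooth.continuous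
  have hi : ∀ {g : ℝ → ℝ}, Continuous g → IntervalIntegrable g volume 0 ((b - a) / 2) :=
    fun hg => hg.intervalIntegrable _ _
  rw [integral_Ioo_eq hab, integral_eq_add_halves a b (by fun_prop)]
  simp_rw [IsPair.pairFun_add, h.pairFun_sub]
  rw [← intervalIntegral.integral_add (hi (by fun_prop)) (hi (by fun_prop)),
    ← intervalIntegral.integral_const_mul, ← intervalIntegral.integral_const_mul,
    ← intervalIntegral.integral_add (hi (by fun_prop)) (hi (by fun_prop)),
    ← intervalIntegral.integral_const_mul]
  congr 1; ext x; ring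

lemma IsPair.energy_pairFun (hab : a < b) (h : IsPair ((b - a) / 2) α lam mu φ ψ) (s t : ℝ) :
    energy a b α (pairFun a b φ ψ s t) =
      2 * (s ^ 2 * (lam * ∫ x in (0 : ℝ)..(b - a) / 2, φ x ^ 2) +
        t ^ 2 * (mu * ∫ x in (0 : ℝ)..(b - a) / 2, ψ x ^ 2)) := by
  have h0 : ψ 0 = 0 := by
    have := h.odd 0
    simp only [neg_zero] at this
    linarith
  rw [energy_eq_add_halves hab α (h.contDiff_pairFun s t)]
  simp_rw [IsPair.pairFun_add, h.pairFun_sub]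
  exact halfEnergy_add_halfEnergy h.evenSol h.deriv_zero h.bc_even h.oddSol h0 h.bc_odd s t

lemma IsPair.integral_pairFun_sq_pos (hab : a < b) (h : IsPair ((b - a) / 2) α lam mu φ ψ)
    {s t : ℝ} (hst : s ≠ 0 ∨ t ≠ 0) :
    0 < ∫ x in Set.Ioo a b, pairFun a b φ ψ s t x ^ 2 := by
  rw [h.integral_pairFun_sq hab]
  have := h.even_pos
  have := h.odd_pos
  rcases hst with h | h <;> positivity

lemma IsPair.energy_pairFun_le (hab : a < b) (h : IsPair ((b - a) / 2) α lam mu φ ψ)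
    {s t m : ℝ} (hm : lam ≤ m) (ht : t = 0 ∨ mu ≤ m) :
    energy a b α (pairFun a b φ ψ s t) ≤
      m * ∫ x in Set.Ioo a b, pairFun a b φ ψ s t x ^ 2 := by
  rw [h.integral_pairFun_sq hab, h.energy_pairFun hab]
  have h1 := mul_le_mul_of_nonneg_right hm (mul_nonneg (sq_nonneg s) h.even_pos.le)
  rcases ht with rfl | ht
  · linarith
  · have h2 := mul_le_mul_of_nonneg_right ht (mul_nonneg (sq_nonneg t) h.odd_pos.le)
    linarith

end PairFun

/-! ### Trial spaces on the box. -/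

section Bounds

variable {n : ℕ} {a b : Fin n → ℝ} {α : ℝ} {lam mu : Fin n → ℝ} {φ ψ : Fin n → ℝ → ℝ}

lemma update_eq_pairFun_one (j : Fin n) (v : Fin 1 → ℝ) (i : Fin n) :
    ∃ s t, Function.update (fun i => pairFun (a i) (b i) (φ i) (ψ i) 1 0) j
        (fun x => ∑ l, v l * pairFun (a j) (b j) (φ j) (ψ j) 1 0 x) i =
          pairFun (a i) (b i) (φ i) (ψ i) s t ∧ (v ≠ 0 → s ≠ 0 ∨ t ≠ 0) ∧ t = 0 := by
  rcases eq_or_ne i j with rfl | hij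
  · refine ⟨v 0, 0, ?_, fun hv => Or.inl fun h0 => hv ?_, rfl⟩
    · rw [Function.update_self]
      ext x
      simp [pairFun]
    · ext l
      rw [Subsingleton.elim l 0, h0, Pi.zero_apply]
  · exact ⟨1, 0, by rw [Function.update_of_ne hij], fun _ => Or.inl one_ne_zero, rfl⟩

/-- Every factor of a trial function is again a combination of the even and odd states, with an odd
part possible only in slot `j`. Slot `j` may thus use `mu j` while all others keep `lam i`. -/
lemma update_eq_pairFun_two (j : Fin n) (v : Fin 2 → ℝ) (i : Fin n) :
    ∃ s t, Function.update (fun i => pairFun (a i) (b i) (φ i) (ψ i) 1 0) j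
        (fun x => ∑ l, v l * ![pairFun (a j) (b j) (φ j) (ψ j) 1 0,
          pairFun (a j) (b j) (φ j) (ψ j) 0 1] l x) i =
          pairFun (a i) (b i) (φ i) (ψ i) s t ∧ (v ≠ 0 → s ≠ 0 ∨ t ≠ 0) ∧
          (t = 0 ∨ mu i ≤ Function.update lam j (mu j) i) := by
  rcases eq_or_ne i j with rfl | hij
  · refine ⟨v 0, v 1, ?_, fun hv => ?_, Or.inr (by rw [Function.update_self])⟩
    · rw [Function.update_self]
      ext x
      simp [pairFun, Fin.sum_univ_two]
    · by_contra! hcon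
      exact hv (by ext l; fin_cases l <;> simp [hcon])
  · exact ⟨1, 0, by rw [Function.update_of_ne hij], fun _ => Or.inl one_ne_zero, Or.inl rfl⟩

lemma sum_update_eq (j : Fin n) :
    ∑ i, Function.update lam j (mu j) i = ∑ i, lam i + (mu j - lam j) := by
  rw [Finset.sum_update_of_mem (Finset.mem_univ j), ← Finset.add_sum_erase _ lam
    (Finset.mem_univ j), Finset.sdiff_singleton_eq_erase]
  ring

lemma le_update (h : ∀ i, lam i ≤ mu i) (i j : Fin n) :
    lam i ≤ Function.update lam j (mu j) i := by
  rcases eq_or_ne i j with rfl | hij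
  · rw [Function.update_self]
    exact h i
  · rw [Function.update_of_ne hij]

lemma sum_mem_robinBounds_one (hab : ∀ i, a i < b i) (j : Fin n)
    (h : ∀ i, IsPair ((b i - a i) / 2) α (lam i) (mu i) (φ i) (ψ i)) :
    ∑ i, lam i ∈ robinBounds a b α 1 := by
  refine sum_mem_robinBounds j (φ := fun i => pairFun (a i) (b i) (φ i) (ψ i) 1 0)
    (χ := fun _ => pairFun (a j) (b j) (φ j) (ψ j) 1 0) (fun v i => ?_) (fun v hv i => ?_)
    (fun v i => ?_) <;>
  obtain ⟨s, t, he, hst, ht⟩ := update_eq_pairFun_one (a := a) (b := b) (φ := φ) (ψ := ψ) j v i <;>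
  rw [he]
  · exact (h i).contDiff_pairFun s t
  · exact (h i).integral_pairFun_sq_pos (hab i) (hst hv)
  · exact (h i).energy_pairFun_le (hab i) le_rfl (Or.inl ht)

lemma sum_mem_robinBounds_two (hab : ∀ i, a i < b i) (j : Fin n)
    (h : ∀ i, IsPair ((b i - a i) / 2) α (lam i) (mu i) (φ i) (ψ i)) :
    ∑ i, lam i + (mu j - lam j) ∈ robinBounds a b α 2 := by
  rw [← sum_update_eq]
  refine sum_mem_robinBounds j (φ := fun i => pairFun (a i) (b i) (φ i) (ψ i) 1 0)
    (χ := ![pairFun (a j) (b j) (φ j) (ψ j) 1 0, pairFun (a j) (b j) (φ j) (ψ j) 0 1])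
    (fun v i => ?_) (fun v hv i => ?_) (fun v i => ?_) <;>
  obtain ⟨s, t, he, hst, ht⟩ := update_eq_pairFun_two (a := a) (b := b) (φ := φ) (ψ := ψ)
    (lam := lam) (mu := mu) j v i <;>
  rw [he]
  · exact (h i).contDiff_pairFun s t
  · exact (h i).integral_pairFun_sq_pos (hab i) (hst hv)
  · exact (h i).energy_pairFun_le (hab i) (le_update (fun i => (h i).le) i j) ht

lemma IsPair.pairFun_left {a b α lam mu : ℝ} {φ ψ : ℝ → ℝ}
    (h : IsPair ((b - a) / 2) α lam mu φ ψ) (h1 : φ ((b - a) / 2) = 0)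
    (h2 : ψ ((b - a) / 2) = 0) (s t : ℝ) : pairFun a b φ ψ s t a = 0 := by
  have := h.pairFun_sub s t ((b - a) / 2)
  rwa [show (a + b) / 2 - (b - a) / 2 = a by ring, h1, h2, mul_zero, mul_zero, sub_zero] at this

lemma IsPair.pairFun_right {a b : ℝ} {φ ψ : ℝ → ℝ} (h1 : φ ((b - a) / 2) = 0)
    (h2 : ψ ((b - a) / 2) = 0) (s t : ℝ) : pairFun a b φ ψ s t b = 0 := by
  have := IsPair.pairFun_add (a := a) (b := b) (φ := φ) (ψ := ψ) s t ((b - a) / 2)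
  rwa [show (a + b) / 2 + (b - a) / 2 = b by ring, h1, h2, mul_zero, mul_zero, add_zero] at this

lemma sum_mem_dirichletBounds_one (hab : ∀ i, a i < b i) (j : Fin n)
    (h : ∀ i, IsPair ((b i - a i) / 2) 0 (lam i) (mu i) (φ i) (ψ i))
    (h1 : ∀ i, φ i ((b i - a i) / 2) = 0) (h2 : ∀ i, ψ i ((b i - a i) / 2) = 0) :
    ∑ i, lam i ∈ dirichletBounds a b 1 := by
  refine sum_mem_dirichletBounds hab j (φ := fun i => pairFun (a i) (b i) (φ i) (ψ i) 1 0)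
    (χ := fun _ => pairFun (a j) (b j) (φ j) (ψ j) 1 0) (fun v i => ?_) (fun v hv i => ?_)
    (fun v i => ?_) (fun v i => ?_) (fun v i => ?_) <;>
  obtain ⟨s, t, he, hst, ht⟩ := update_eq_pairFun_one (a := a) (b := b) (φ := φ) (ψ := ψ) j v i <;>
  rw [he]
  · exact (h i).contDiff_pairFun s t
  · exact (h i).integral_pairFun_sq_pos (hab i) (hst hv)
  · exact (h i).energy_pairFun_le (hab i) le_rfl (Or.inl ht)
  · exact (h i).pairFun_left (h1 i) (h2 i) s t
  · exact IsPair.pairFun_right (h1 i) (h2 i) s t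

lemma sum_mem_dirichletBounds_two (hab : ∀ i, a i < b i) (j : Fin n)
    (h : ∀ i, IsPair ((b i - a i) / 2) 0 (lam i) (mu i) (φ i) (ψ i))
    (h1 : ∀ i, φ i ((b i - a i) / 2) = 0) (h2 : ∀ i, ψ i ((b i - a i) / 2) = 0) :
    ∑ i, lam i + (mu j - lam j) ∈ dirichletBounds a b 2 := by
  rw [← sum_update_eq]
  refine sum_mem_dirichletBounds hab j (φ := fun i => pairFun (a i) (b i) (φ i) (ψ i) 1 0)
    (χ := ![pairFun (a j) (b j) (φ j) (ψ j) 1 0, pairFun (a j) (b j) (φ j) (ψ j) 0 1])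
    (fun v i => ?_) (fun v hv i => ?_) (fun v i => ?_) (fun v i => ?_) (fun v i => ?_) <;>
  obtain ⟨s, t, he, hst, ht⟩ := update_eq_pairFun_two (a := a) (b := b) (φ := φ) (ψ := ψ)
    (lam := lam) (mu := mu) j v i <;>
  rw [he]
  · exact (h i).contDiff_pairFun s t
  · exact (h i).integral_pairFun_sq_pos (hab i) (hst hv)
  · exact (h i).energy_pairFun_le (hab i) (le_update (fun i => (h i).le) i j) ht
  · exact (h i).pairFun_left (h1 i) (h2 i) s t
  · exact IsPair.pairFun_right (h1 i) (h2 i) s t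

end Bounds

/-! ### The eigenvalues of the box -/

section Eigenvalues

variable {n : ℕ} [NeZero n] {a b : Fin n → ℝ}

/-- The smallest of finitely many numbers. -/
noncomputable def minGap (g : Fin n → ℝ) : ℝ := Finset.univ.inf' Finset.univ_nonempty g

lemma minGap_le (g : Fin n → ℝ) (i : Fin n) : minGap g ≤ g i :=
  Finset.inf'_le _ (Finset.mem_univ i)

lemma exists_eq_minGap (g : Fin n → ℝ) : ∃ j, minGap g = g j := by
  obtain ⟨j, -, hj⟩ := Finset.exists_mem_eq_inf' Finset.univ_nonempty g
  exact ⟨j, hj⟩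

lemma continuous_minGap : Continuous (minGap : (Fin n → ℝ) → ℝ) :=
  Continuous.finset_inf'_apply _ fun i _ => continuous_apply i

lemma minGap_lt_minGap {g g' : Fin n → ℝ} (h : ∀ i, g i < g' i) : minGap g < minGap g' := by
  obtain ⟨j, hj⟩ := exists_eq_minGap g'
  rw [hj]
  exact (minGap_le g j).trans_lt (h j)

variable {α : ℝ} {lam mu : Fin n → ℝ} {φ ψ : Fin n → ℝ → ℝ}

lemma isGroundState_minGap (hab : ∀ i, a i < b i)
    (h : ∀ i, IsEvenState ((b i - a i) / 2) α (lam i) (φ i))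
    (k : ∀ i, IsOddState ((b i - a i) / 2) α (mu i) (ψ i)) (i : Fin n) :
    IsGroundState (a i) (b i) α (lam i) (minGap fun i => mu i - lam i)
      (normalizedState (a i) (b i) (φ i)) :=
  ((h i).isGroundState (hab i) (k i)).mono (minGap_le _ i)

lemma minGap_nonneg (hab : ∀ i, a i < b i)
    (h : ∀ i, IsEvenState ((b i - a i) / 2) α (lam i) (φ i))
    (k : ∀ i, IsOddState ((b i - a i) / 2) α (mu i) (ψ i)) :
    0 ≤ minGap fun i => mu i - lam i := by
  obtain ⟨j, hj⟩ := exists_eq_minGap fun i => mu i - lam i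
  rw [hj]
  exact (sub_pos.2 ((h j).lt_of_isOddState (by linarith [hab j]) (k j))).le

/-- Attainment together with the lower bound identifies the `sInf` and excludes its default values
on empty or unbounded sets. -/
lemma isLeast_robinBounds_one (hab : ∀ i, a i < b i)
    (h : ∀ i, IsEvenState ((b i - a i) / 2) α (lam i) (φ i))
    (k : ∀ i, IsOddState ((b i - a i) / 2) α (mu i) (ψ i)) :
    IsLeast (robinBounds a b α 1) (∑ i, lam i) :=
  ⟨sum_mem_robinBounds_one hab 0 fun i => (h i).isPair (by linarith [hab i]) (k i),
    fun _ hc => le_of_mem_robinBounds_one (minGap_nonneg hab h k)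
      (isGroundState_minGap hab h k) hc⟩

lemma isLeast_robinBounds_two (hab : ∀ i, a i < b i)
    (h : ∀ i, IsEvenState ((b i - a i) / 2) α (lam i) (φ i))
    (k : ∀ i, IsOddState ((b i - a i) / 2) α (mu i) (ψ i)) :
    IsLeast (robinBounds a b α 2) (∑ i, lam i + minGap fun i => mu i - lam i) := by
  refine ⟨?_, fun _ hc => le_of_mem_robinBounds_two (minGap_nonneg hab h k)
      (isGroundState_minGap hab h k) hc⟩
  obtain ⟨j, hj⟩ := exists_eq_minGap fun i => mu i - lam i
  rw [hj]
  exact sum_mem_robinBounds_two hab j fun i => (h i).isPair (by linarith [hab i]) (k i)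

lemma robinGap_eq (hab : ∀ i, a i < b i)
    (h : ∀ i, IsEvenState ((b i - a i) / 2) α (lam i) (φ i))
    (k : ∀ i, IsOddState ((b i - a i) / 2) α (mu i) (ψ i)) :
    robinGap a b α = minGap fun i => mu i - lam i := by
  have h1 : robinEigenvalue a b α 1 = _ := (isLeast_robinBounds_one hab h k).csInf_eq
  have h2 : robinEigenvalue a b α 2 = _ := (isLeast_robinBounds_two hab h k).csInf_eq
  rw [robinGap, h1, h2, add_sub_cancel_left]

lemma dirichletGap_eq (hab : ∀ i, a i < b i) :
    dirichletGap a b = minGap fun i =>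
      (Real.pi / ((b i - a i) / 2)) ^ 2 - (Real.pi / (2 * ((b i - a i) / 2))) ^ 2 := by
  have hℓ : ∀ i, 0 < (b i - a i) / 2 := fun i => by linarith [hab i]
  choose lam φ h using fun i α => exists_isEvenState (hℓ i) α
  choose mu ψ k using fun i α => exists_isOddState (hℓ i) α
  have t1 : Tendsto (fun α => ∑ i, lam i α) atTop
      (𝓝 (∑ i, (Real.pi / (2 * ((b i - a i) / 2))) ^ 2)) :=
    tendsto_finsetSum _ fun i _ => tendsto_even_atTop (hℓ i) (h i)
  have t2 : Tendsto (fun α => minGap fun i => mu i α - lam i α) atTop (𝓝 (minGap fun i =>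
      (Real.pi / ((b i - a i) / 2)) ^ 2 - (Real.pi / (2 * ((b i - a i) / 2))) ^ 2)) :=
    (continuous_minGap.tendsto _).comp (tendsto_pi_nhds.2 fun i =>
      (tendsto_odd_atTop (hℓ i) (k i)).sub (tendsto_even_atTop (hℓ i) (h i)))
  have hpair := fun i => isPair_dirichlet (hℓ i)
  have z1 : ∀ i, Real.cos (Real.pi / (2 * ((b i - a i) / 2)) * ((b i - a i) / 2)) = 0 := by
    intro i
    have := (hℓ i).ne'
    rw [show Real.pi / (2 * ((b i - a i) / 2)) * ((b i - a i) / 2) = Real.pi / 2 by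
      generalize (b i - a i) / 2 = z at *; field_simp, Real.cos_pi_div_two]
  have z2 : ∀ i, Real.sin (Real.pi / ((b i - a i) / 2) * ((b i - a i) / 2)) = 0 := by
    intro i
    have := (hℓ i).ne'
    rw [div_mul_cancel₀ _ this, Real.sin_pi]
  -- A Dirichlet bound `c` lies above the Robin minimum for every `α`, hence above its limit as `α →
  -- ∞`; the sine and cosine products attain that limit.
  have l1 : IsLeast (dirichletBounds a b 1) (∑ i, (Real.pi / (2 * ((b i - a i) / 2))) ^ 2) :=
    ⟨sum_mem_dirichletBounds_one hab 0 hpair z1 z2, fun c hc =>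
      le_of_tendsto' t1 fun α => (isLeast_robinBounds_one hab (fun i => h i α)
        (fun i => k i α)).2 (dirichletBounds_subset_robinBounds α 1 hc)⟩
  have l2 : IsLeast (dirichletBounds a b 2) (∑ i, (Real.pi / (2 * ((b i - a i) / 2))) ^ 2 +
      minGap fun i => (Real.pi / ((b i - a i) / 2)) ^ 2 -
        (Real.pi / (2 * ((b i - a i) / 2))) ^ 2) := by
    refine ⟨?_, fun c hc => le_of_tendsto' (t1.add t2) fun α =>
      (isLeast_robinBounds_two hab (fun i => h i α)
        (fun i => k i α)).2 (dirichletBounds_subset_robinBounds α 2 hc)⟩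
    obtain ⟨j, hj⟩ := exists_eq_minGap fun i =>
      (Real.pi / ((b i - a i) / 2)) ^ 2 - (Real.pi / (2 * ((b i - a i) / 2))) ^ 2
    rw [hj]
    exact sum_mem_dirichletBounds_two hab j hpair z1 z2
  have e1 : dirichletEigenvalue a b 1 = _ := l1.csInf_eq
  have e2 : dirichletEigenvalue a b 2 = _ := l2.csInf_eq
  rw [dirichletGap, e1, e2, add_sub_cancel_left]

end Eigenvalues

end RobinBox

theorem mainTheorem4 (n : ℕ) (hn : 1 ≤ n) (a b : Fin n → ℝ) (hab : ∀ i, a i < b i) :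
    StrictMono (fun α : ℝ => RobinBox.robinGap a b α) ∧
    Tendsto (fun α : ℝ => RobinBox.robinGap a b α) atBot (𝓝 0) ∧
    Tendsto (fun α : ℝ => RobinBox.robinGap a b α) atTop (𝓝 (RobinBox.dirichletGap a b)) := by
  -- The minimum over the sides needs at least one side; this is where `1 ≤ n` enters.
  have : NeZero n := ⟨by omega⟩
  have hℓ : ∀ i, 0 < (b i - a i) / 2 := fun i => by linarith [hab i]
  choose lam φ h using fun i α => RobinBox.exists_isEvenState (hℓ i) α
  choose mu ψ k using fun i α => RobinBox.exists_isOddState (hℓ i) α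
  have hgap : ∀ α, RobinBox.robinGap a b α = RobinBox.minGap fun i => mu i α - lam i α :=
    fun α => RobinBox.robinGap_eq hab (fun i => h i α) (fun i => k i α)
  simp_rw [hgap]
  refine ⟨fun α β hαβ => RobinBox.minGap_lt_minGap fun i =>
    RobinBox.gap_lt_gap (hℓ i) hαβ (h i α) (k i α) (h i β) (k i β), ?_, ?_⟩
  · have h0 : RobinBox.minGap (fun _ : Fin n => (0 : ℝ)) = 0 :=
      (RobinBox.exists_eq_minGap fun _ : Fin n => (0 : ℝ)).choose_spec
    rw [← h0]
    exact (RobinBox.continuous_minGap.tendsto _).comp (tendsto_pi_nhds.2 fun i =>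
      RobinBox.tendsto_gap_atBot (hℓ i) (h i) (k i))
  · rw [RobinBox.dirichletGap_eq hab]
    exact (RobinBox.continuous_minGap.tendsto _).comp (tendsto_pi_nhds.2 fun i =>
      (RobinBox.tendsto_odd_atTop (hℓ i) (k i)).sub (RobinBox.tendsto_even_atTop (hℓ i) (h i)))
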